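/- **Theorem 1.6.** Logarithms are binary; the order of a path is its number of vertices; all graphs are finite and simple. A graph is $k$-degenerate if each of its nonempty subgraphs has a vertex of degree at most $k$. A Hamiltonian path is a path that visits all vertices. 1. There is a constant $c$ such that for infinitely many integers $n$ there is a 2-degenerate graph $G$ with exactly $n$ vertices that has a Hamiltonian path (so a path of order $n$) and has no induced path of order more than $c(\log\log n)^2$. 2. There is a constant $c$ such that for every integer $\ell\ge 1$ every graph $G_\ell$, constructed as below with any choices, has at least $2^{2^{\ell+1}}$ vertices, is 2-degenerate, has a Hamiltonian path, and has no induced path of order more than $c\,\ell^2$. 3. Consequently the conjecture of Esperet, Lemoine and Maffray fails for every $k\ge 2$: there is no constant $c>0$ such that every $k$-degenerate graph with a path of order $n\ge 1$ has an induced path of order at least $(\log n)^c$. *Construction of $G_\ell$.* Let $h(1)=3$ and $h(\ell)=2+2h(\ell-1)$ for $\ell>1$. Let $\mathcal N_1=\{(1,3)\}$ and, for $\ell>1$, $$\mathcal N_\ell=\{(1,h(\ell))\}\cup(\mathcal N_{\ell-1}\oplus 1)\cup(\mathcal N_{\ell-1}\oplus(h(\ell-1)+1)),$$ where $X\oplus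 i=\{(x+i,x'+i):(x,x')\in X\}$. Let $B_\ell$ be the complete binary tree of depth $h(\ell)$, where the depth of a node is the number of nodes on the path from it to the root (the root has depth 1). Replace every node $s$ of $B_\ell$ by a triangle $K^s$, and assign injectively to the neighbours of $s$ in $B_\ell$ edges of $K^s$. For every tree edge $st$ with $s$ the parent of $t$, join the two endpoints of the edge of $K^s$ assigned to $t$ to the two endpoints of the edge of $K^t$ assigned to $s$ by two disjoint paths $u_1x_1y_1v_1$ and $u_2x_2y_2v_2$, where $x_1,x_2,y_1,y_2$ are new vertices; $x_1,x_2$ are the top-predecessors and $y_1,y_2$ the bottom-predecessors of $t$. The top edge of $K^t$ is the edge assigned to the parent of $t$; if $t$ is the root, it is the edge of $K^t$ that is assigned to no child. Finally, for every pair of nodes $s,t$ such that $s$ is a proper ancestor of $t$ and $(\mathrm{depth}(s),\mathrm{depth}(t))\in\mathcal N_\ell$, add edges (ribs) joining one endpoint of the top edge of $K^s$ to both top-predecessors of $t$ and the other endpoint to both bottom-predecessors of $t$. All assignments, the pairing of endpoints in the two paths, and, for each pair $(s,t)$, the roles of the two endpoints of the top edge in the ribs are arbitrary. -/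

import Mathlib

namespace RibbedBlowUp

/-- `G` is `k`-degenerate: every (nonempty) subgraph of `G` has a vertex of degree at most `k`. -/
def IsDegenerate {V : Type*} (G : SimpleGraph V) (k : ℕ) : Prop :=
  ∀ H : G.Subgraph, H.verts.Nonempty → ∃ v ∈ H.verts, (H.neighborSet v).encard ≤ k

/-- `G` has a Hamiltonian path: a path that visits all its vertices. -/
def HasHamiltonianPath {V : Type*} (G : SimpleGraph V) : Prop :=
  ∃ (u v : V) (P : G.Walk u v), P.IsPath ∧ ∀ w : V, w ∈ P.support

/-- The depths `h(1) = 3`, `h(ℓ) = 2 + 2 h(ℓ - 1)` (the value at `0` is never used). -/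
def h : ℕ → ℕ
  | 0 => 0
  | 1 => 3
  | l + 2 => 2 + 2 * h (l + 1)

/-- `X ⊕ i`, the set of pairs of `X` with both entries increased by `i`. -/
def shift (X : Finset (ℕ × ℕ)) (i : ℕ) : Finset (ℕ × ℕ) :=
  X.image fun x => (x.1 + i, x.2 + i)

/-- The nested interval systems `𝓝_ℓ` (the value at `0` is never used). -/
def nested : ℕ → Finset (ℕ × ℕ)
  | 0 => ∅
  | 1 => {(1, 3)}
  | l + 2 =>
      {(1, h (l + 2))} ∪ (shift (nested (l + 1)) 1 ∪ shift (nested (l + 1)) (h (l + 1) + 1))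

/-- The nodes of the complete binary tree of depth `p`: binary words of length `< p`.
The root is the empty word, the children of `s` are the two words `b :: s`, and `s` is an ancestor
of `t` (`s ⪯ t`) if and only if `s` is a suffix of `t`. -/
abbrev Node (p : ℕ) : Type := {s : List Bool // s.length < p}

/-- The depth of a node: the number of nodes on the path to the root, so the root has depth `1`. -/
def Node.depth {p : ℕ} (s : Node p) : ℕ := s.1.length + 1

/-- The vertices of the blow-up of the complete binary tree of depth `p`. The two paths that replace
the tree edge from the parent of `t` to `t` are told apart by a Boolean `side`
(`false` for `L`, `true` for `R`). -/
inductive Vertex (p : ℕ) : Type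
  /-- The three vertices of the clique `K^s`. -/
  | clique (s : Node p) (i : Fin 3) : Vertex p
  /-- The top-predecessors `x₁, x₂` of the non-root node `t`. -/
  | top (t : Node p) (ht : t.1 ≠ []) (side : Bool) : Vertex p
  /-- The bottom-predecessors `y₁, y₂` of the non-root node `t`. -/
  | bot (t : Node p) (ht : t.1 ≠ []) (side : Bool) : Vertex p

/-- The arbitrary choices made in the construction.

The three edges of the triangle `K^s` are assigned injectively to the three ports of `s`:
the port `some b` leads to the child `b :: s`, and the port `none` leads to the parent of `s`.
Thus the edge at `none` is the top edge of `K^s`; at the root it is the only edge that is not assigned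
to a child. The ports `some b` of the leaves are not used. The edge `e` of `K^s` has the endpoints
`att s e false` and `att s e true`, which are the ends in `K^s` of the `L`-path and of the `R`-path
that are attached to this edge.

`orient s t` tells which endpoint of the top edge of `K^s` plays the role of `u₁` in the ribs
from `s` to `t`. -/
structure Choices (p : ℕ) where
  att : Node p → Option Bool → Bool → Fin 3
  att_ne : ∀ s e, att s e false ≠ att s e true
  att_inj : ∀ s e f, s(att s e false, att s e true) = s(att s f false, att s f true) → e = f
  orient : Node p → Node p → Bool

/-- Choices exist. -/
instance (p : ℕ) : Nonempty (Choices p) :=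
  ⟨{ att := fun _ e side =>
      match e, side with
      | none, false => 0
      | none, true => 1
      | some false, false => 0
      | some false, true => 2
      | some true, false => 1
      | some true, true => 2
     att_ne := by
      intro _ e
      rcases e with _ | _ | _ <;> decide
     att_inj := by
      intro _ e f
      rcases e with _ | _ | _ <;> rcases f with _ | _ | _ <;> decide
     orient := fun _ _ => false }⟩

/-- The edges (each in one direction) of the blow-up of the complete binary tree of depth `p`. -/
inductive BlowUpEdge {p : ℕ} (c : Choices p) : Vertex p → Vertex p → Prop
  | triangle (s : Node p) (i j : Fin 3) (hij : i ≠ j) :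
      BlowUpEdge c (.clique s i) (.clique s j)
  | ux (s t : Node p) (ht : t.1 ≠ []) (b : Bool) (hst : t.1 = b :: s.1) (side : Bool) :
      BlowUpEdge c (.clique s (c.att s (some b) side)) (.top t ht side)
  | xy (t : Node p) (ht : t.1 ≠ []) (side : Bool) :
      BlowUpEdge c (.top t ht side) (.bot t ht side)
  | yv (t : Node p) (ht : t.1 ≠ []) (side : Bool) :
      BlowUpEdge c (.bot t ht side) (.clique t (c.att t none side))

/-- The edges of `ribs(s, t)` for `s ≺ t`: with `u₁u₂` the top edge of `K^s`, they join `u₁` to both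
top-predecessors of `t` and `u₂` to both bottom-predecessors of `t`. -/
inductive Rib {p : ℕ} (c : Choices p) (s t : Node p) : Vertex p → Vertex p → Prop
  | top (ht : t.1 ≠ []) (side : Bool) :
      Rib c s t (.clique s (c.att s none (c.orient s t))) (.top t ht side)
  | bot (ht : t.1 ≠ []) (side : Bool) :
      Rib c s t (.clique s (c.att s none (!c.orient s t))) (.bot t ht side)

/-- The graph `G_ℓ`: the blow-up of the complete binary tree of depth `h ℓ`, with the ribs added for
all pairs `s ≺ t` of nodes whose depths form an interval of the nested system. -/
def ribbedGraph (l : ℕ) (c : Choices (h l)) : SimpleGraph (Vertex (h l)) :=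
  SimpleGraph.fromRel fun u v =>
    BlowUpEdge c u v ∨
      ∃ s t : Node (h l), s.1 <:+ t.1 ∧ s ≠ t ∧ (s.depth, t.depth) ∈ nested l ∧ Rib c s t u v

end RibbedBlowUp

namespace RibbedBlowUp

/-! ### Words, kinds of vertices, and adjacency -/

/-! The graph is sparse and traversable because it is a thickened tree with few ribs per node; long
induced paths are excluded because the ribs make it cheap to go from the top of a level to its
bottom.

Call level `j` with root `r` the part of the graph below `r` on `h j` consecutive depths where
`nested l` is a copy of `nested j`. Each endpoint of the top edge of `K^r` sees, for every deepest
node `t` of the level, either all top-predecessors or all bottom-predecessors of `t`. An induced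
path that uses such an endpoint can therefore make only a bounded number of further steps before
reaching the triangle of a deepest node (`ZonePath.topEdge_leaf_le`). A path entering the level
through a top-predecessor of `r` is forced onto the top edge, so a passage from entrance to leaf has
bounded length (`ZonePath.top_leaf_le`).

A level `j + 1` consists of its root, a first layer of levels `j`, a second layer of levels `j`, and
a deepest layer of single nodes. Away from the root no rib crosses between layers. Tree edges alone
do not allow an induced path to enter a branch and come back, since both crossings would use the
triangle of the same parent (`IndPath.no_return`). So such a path climbs and then descends
(`ZonePath.decomp`): it visits at most one level of the first layer, with at most one level of the
second layer and one deepest node on either side. Complete passages from top to leaf cost a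
constant, and three bounds follow by induction: - between two leaves, only one sublevel is traversed
from leaf to leaf, hence linear (`leafBound`); - with one end at a leaf or at the entrance, each
step adds a leaf-to-leaf bound, hence quadratic (`startBound`); - with free ends, two such halves
are combined, still quadratic (`fullBound`).

Degeneracy comes from the order of construction, in which every vertex has at most two neighbours
that are not later (`exists_pair_of_adj`). A Hamiltonian path arises recursively, because the two
edges of a triangle assigned to children form a path between the ends of its top edge
(`exists_ports`, `exists_traversal`). The order is doubly exponential in `l`, so `l` is at most the
iterated logarithm of the order. -/

/-- The node of the tree (as a binary word) to which a vertex of the blow-up belongs. -/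
def Vertex.word {p : ℕ} : Vertex p → List Bool
  | .clique s _ => s.1
  | .top t _ _ => t.1
  | .bot t _ _ => t.1

/-- The vertex lies in one of the triangles. -/
def Vertex.IsClique {p : ℕ} : Vertex p → Prop
  | .clique _ _ => True
  | _ => False

/-- The vertex is a top-predecessor. -/
def Vertex.IsTop {p : ℕ} : Vertex p → Prop
  | .top _ _ _ => True
  | _ => False

/-- The vertex is a bottom-predecessor. -/
def Vertex.IsBot {p : ℕ} : Vertex p → Prop
  | .bot _ _ _ => True
  | _ => False

/-- The vertex is an endpoint of the top edge of its triangle. -/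
def Vertex.OnTopEdge {p : ℕ} (c : Choices p) (v : Vertex p) : Prop :=
  ∃ s side, v = .clique s (c.att s none side)

/-- `u` lies in a triangle and `v` is a top-predecessor of a child. -/
def TreeStep {p : ℕ} (u v : Vertex p) : Prop :=
  u.IsClique ∧ v.IsTop ∧ ∃ b, v.word = b :: u.word

/-- `u` and `v` have the shape of the ends of a rib. -/
def RibStep {p : ℕ} (c : Choices p) (N : Finset (ℕ × ℕ)) (u v : Vertex p) : Prop :=
  u.OnTopEdge c ∧ ¬ v.IsClique ∧ u.word <:+ v.word ∧ u.word.length < v.word.length ∧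
    (u.word.length + 1, v.word.length + 1) ∈ N

theorem Vertex.OnTopEdge.isClique {p : ℕ} {c : Choices p} {v : Vertex p} (hv : v.OnTopEdge c) :
    v.IsClique := by
  obtain ⟨s, side, rfl⟩ := hv
  trivial

theorem Vertex.IsTop.not_isClique {p : ℕ} {v : Vertex p} (hv : v.IsTop) : ¬ v.IsClique := by
  cases v <;> simp_all [Vertex.IsTop, Vertex.IsClique]

theorem Vertex.IsBot.not_isClique {p : ℕ} {v : Vertex p} (hv : v.IsBot) : ¬ v.IsClique := by
  cases v <;> simp_all [Vertex.IsBot, Vertex.IsClique]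

theorem Vertex.IsBot.not_isTop {p : ℕ} {v : Vertex p} (hv : v.IsBot) : ¬ v.IsTop := by
  cases v <;> simp_all [Vertex.IsBot, Vertex.IsTop]

theorem TreeStep.length {p : ℕ} {u v : Vertex p} (huv : TreeStep u v) :
    v.word.length = u.word.length + 1 := by
  obtain ⟨-, -, b, hb⟩ := huv
  simp [hb]

theorem TreeStep.suffix {p : ℕ} {u v : Vertex p} (huv : TreeStep u v) : u.word <:+ v.word := by
  obtain ⟨-, -, b, hb⟩ := huv
  exact ⟨[b], by simp [hb]⟩

theorem suffix_ne_length {s t : List Bool} (h1 : s <:+ t) (h2 : s ≠ t) : s.length < t.length :=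
  lt_of_le_of_ne h1.length_le fun h => h2 (h1.eq_of_length h)

/-- Two suffixes of the same word that have the same length are equal. -/
theorem suffix_unique {s s' t : List Bool} (h1 : s <:+ t) (h2 : s' <:+ t)
    (h3 : s.length = s'.length) : s = s' :=
  (List.suffix_of_suffix_length_le h1 h2 h3.le).eq_of_length h3

section Adjacency

variable {l : ℕ} {c : Choices (h l)} {u v : Vertex (h l)}

/-- This classification keeps little more than the comparison of words, which is all that the
arguments about crossing depths use. -/
theorem adj_cases (huv : (ribbedGraph l c).Adj u v) :
    u.word = v.word ∨ TreeStep u v ∨ TreeStep v u ∨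
      RibStep c (nested l) u v ∨ RibStep c (nested l) v u := by
  have key : ∀ u v : Vertex (h l), (BlowUpEdge c u v ∨
      ∃ s t : Node (h l), s.1 <:+ t.1 ∧ s ≠ t ∧ (s.depth, t.depth) ∈ nested l ∧ Rib c s t u v) →
      u.word = v.word ∨ TreeStep u v ∨ RibStep c (nested l) u v := by
    rintro u v (e | ⟨s, t, h1, h2, h3, h4⟩)
    · cases e with
      | triangle s i j hij => exact Or.inl rfl
      | ux s t ht b hst side => exact Or.inr (Or.inl ⟨trivial, trivial, b, hst⟩)
      | xy t ht side => exact Or.inl rfl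
      | yv t ht side => exact Or.inl rfl
    · have h5 := suffix_ne_length h1 (fun h => h2 (Subtype.ext h))
      cases h4 with
      | top ht side =>
        exact Or.inr (Or.inr ⟨⟨_, _, rfl⟩, by simp [Vertex.IsClique], h1, h5, h3⟩)
      | bot ht side =>
        exact Or.inr (Or.inr ⟨⟨_, _, rfl⟩, by simp [Vertex.IsClique], h1, h5, h3⟩)
  rcases huv.2 with e | e
  · rcases key _ _ e with h | h | h <;> simp [h]
  · rcases key _ _ e with h | h | h <;> simp [h]

theorem adj_of_isClique (hu : u.IsClique) (hv : v.IsClique) (huv : u.word = v.word) :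
    u = v ∨ (ribbedGraph l c).Adj u v := by
  cases u <;> cases v <;> simp only [Vertex.IsClique] at hu hv
  rename_i s i t j
  obtain rfl : s = t := Subtype.ext huv
  by_cases hij : i = j
  · simp [hij]
  · exact Or.inr ⟨by simp [hij], Or.inl (Or.inl (.triangle s i j hij))⟩

theorem rib_lt {s t : Node (h l)} {u v : Vertex (h l)} (h1 : s.1 <:+ t.1) (h2 : s ≠ t)
    (h4 : Rib c s t u v) : u.word.length < v.word.length := by
  have h5 := suffix_ne_length h1 (fun h => h2 (Subtype.ext h))
  cases h4 <;> exact h5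

/-- An edge inside a node that is not an edge of the triangle. -/
theorem adj_same_word (huv : (ribbedGraph l c).Adj u v) (hw : u.word = v.word) :
    (u.IsClique ∧ v.IsClique) ∨ (u.IsTop ∧ v.IsBot) ∨ (u.IsBot ∧ v.IsTop) ∨
      (u.IsBot ∧ v.OnTopEdge c) ∨ (u.OnTopEdge c ∧ v.IsBot) := by
  have key : ∀ u v : Vertex (h l), u.word = v.word → (BlowUpEdge c u v ∨
      ∃ s t : Node (h l), s.1 <:+ t.1 ∧ s ≠ t ∧ (s.depth, t.depth) ∈ nested l ∧ Rib c s t u v) →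
      (u.IsClique ∧ v.IsClique) ∨ (u.IsTop ∧ v.IsBot) ∨ (u.IsBot ∧ v.OnTopEdge c) := by
    rintro u v hw (e | ⟨s, t, h1, h2, h3, h4⟩)
    · cases e with
      | triangle s i j hij => exact Or.inl ⟨trivial, trivial⟩
      | ux s t ht b hst side =>
        simp only [Vertex.word] at hw
        rw [hst] at hw
        simp at hw
      | xy t ht side => exact Or.inr (Or.inl ⟨trivial, trivial⟩)
      | yv t ht side => exact Or.inr (Or.inr ⟨trivial, _, _, rfl⟩)
    · have := rib_lt h1 h2 h4
      rw [hw] at this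
      exact absurd this (lt_irrefl _)
  rcases huv.2 with e | e
  · rcases key _ _ hw e with h | h | h <;> simp [h]
  · rcases key _ _ hw.symm e with h | h | h <;> simp [h]

/-- An endpoint of the top edge of `K^s` sees one of any top-predecessor and any
bottom-predecessor of `t` if there are ribs from `s` to `t`. -/
theorem adj_pred_of_onTopEdge {x y : Vertex (h l)} (hu : u.OnTopEdge c) (hx : x.IsTop)
    (hy : y.IsBot) (hxy : x.word = y.word) (hs : u.word <:+ x.word)
    (hlt : u.word.length < x.word.length)
    (hN : (u.word.length + 1, x.word.length + 1) ∈ nested l) :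
    (ribbedGraph l c).Adj u x ∨ (ribbedGraph l c).Adj u y := by
  obtain ⟨s, side, rfl⟩ := hu
  cases x <;> simp only [Vertex.IsTop] at hx
  cases y <;> simp only [Vertex.IsBot] at hy
  rename_i t ht sx t' ht' sy
  obtain rfl : t = t' := Subtype.ext hxy
  have hst : s ≠ t := by
    rintro rfl
    exact lt_irrefl _ hlt
  by_cases ho : side = c.orient s t
  · subst ho
    exact Or.inl ⟨by simp, Or.inl (Or.inr ⟨s, t, hs, hst, hN, .top ht sx⟩)⟩
  · obtain rfl : side = !c.orient s t := by
      cases side <;> cases h : c.orient s t <;> simp_all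
    exact Or.inr ⟨by simp, Or.inl (Or.inr ⟨s, t, hs, hst, hN, .bot ht sy⟩)⟩

/-- A bottom-predecessor sees only one top-predecessor. -/
theorem eq_of_adj_bot {x x' y : Vertex (h l)} (hx : x.IsTop) (hx' : x'.IsTop) (hy : y.IsBot)
    (h1 : (ribbedGraph l c).Adj x y) (h2 : (ribbedGraph l c).Adj x' y) : x = x' := by
  cases y <;> simp only [Vertex.IsBot] at hy
  rename_i t ht side
  have key : ∀ x : Vertex (h l), x.IsTop → (ribbedGraph l c).Adj x (.bot t ht side) →
      x = .top t ht side := by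
    intro x hx hadj
    cases x <;> simp only [Vertex.IsTop] at hx
    rcases hadj.2 with (e | ⟨_, _, -, -, -, e⟩) | (e | ⟨_, _, -, -, -, e⟩) <;> cases e
    rfl
  rw [key x hx h1, key x' hx' h2]

end Adjacency

/-! ### Induced paths, parametrized by intervals of integers -/

/-- The vertices `f i, f (i + 1), …, f k` form an induced path. -/
def IndPath {V : Type*} (G : SimpleGraph V) (f : ℤ → V) (i k : ℤ) : Prop :=
  ∀ a b, i ≤ a → a < b → b ≤ k → f a ≠ f b ∧ (G.Adj (f a) (f b) ↔ b = a + 1)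

theorem IndPath.mono {V : Type*} {G : SimpleGraph V} {f : ℤ → V} {i k i' k' : ℤ}
    (hf : IndPath G f i k) (hi : i ≤ i') (hk : k' ≤ k) : IndPath G f i' k' :=
  fun a b h1 h2 h3 => hf a b (hi.trans h1) h2 (h3.trans hk)

theorem IndPath.reverse {V : Type*} {G : SimpleGraph V} {f : ℤ → V} {i k : ℤ}
    (hf : IndPath G f i k) : IndPath G (fun m => f (-m)) (-k) (-i) := by
  intro a b h1 h2 h3
  have := hf (-b) (-a) (by omega) (by omega) (by omega)
  refine ⟨this.1.symm, ?_⟩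
  rw [G.adj_comm, this.2]
  omega

theorem IndPath.adj_succ {V : Type*} {G : SimpleGraph V} {f : ℤ → V} {i k : ℤ}
    (hf : IndPath G f i k) {a b : ℤ} (h1 : i ≤ a) (h2 : b ≤ k) (hb : b = a + 1) :
    G.Adj (f a) (f b) :=
  (hf a b h1 (by omega) h2).2.2 hb

theorem exists_first {Q : ℤ → Prop} {a b : ℤ} (hab : a ≤ b) (hb : Q b) :
    ∃ m, a ≤ m ∧ m ≤ b ∧ Q m ∧ ∀ n, a ≤ n → n < m → ¬ Q n := by
  obtain ⟨m, ⟨h1, h2⟩, h3⟩ := Int.exists_least_of_bdd (P := fun m => a ≤ m ∧ Q m)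
    ⟨a, fun z hz => hz.1⟩ ⟨b, hab, hb⟩
  exact ⟨m, h1, h3 b ⟨hab, hb⟩, h2, fun n hn hnm hq => by have := h3 n ⟨hn, hq⟩; omega⟩

theorem exists_last {Q : ℤ → Prop} {a b : ℤ} (hab : a ≤ b) (ha : Q a) :
    ∃ m, a ≤ m ∧ m ≤ b ∧ Q m ∧ ∀ n, m < n → n ≤ b → ¬ Q n := by
  obtain ⟨m, h1, h2, h3, h4⟩ := exists_first (Q := fun m => Q (-m)) (a := -b) (b := -a)
    (by omega) (by simpa using ha)
  refine ⟨-m, by omega, by omega, h3, fun n hn hnb hq => h4 (-n) (by omega) (by omega) ?_⟩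
  simpa using hq

/-- Two vertices of an induced path in the same triangle are equal or consecutive. -/
theorem IndPath.clique_le {l : ℕ} {c : Choices (h l)} {f : ℤ → Vertex (h l)} {i k a b : ℤ}
    (hf : IndPath (ribbedGraph l c) f i k) (ha : i ≤ a) (hb : b ≤ k)
    (h1 : (f a).IsClique) (h2 : (f b).IsClique) (h3 : (f a).word = (f b).word) : b ≤ a + 1 := by
  by_contra hab
  have := hf a b ha (by omega) hb
  rcases adj_of_isClique (c := c) h1 h2 h3 with h | h
  · exact this.1 h
  · have := this.2.1 h
    omega

/-! ### The nested interval systems -/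

theorem h_succ {j : ℕ} (hj : 1 ≤ j) : h (j + 1) = 2 + 2 * h j := by
  obtain ⟨j, rfl⟩ := Nat.exists_eq_add_of_le' hj
  rfl

theorem three_le_h {j : ℕ} (hj : 1 ≤ j) : 3 ≤ h j := by
  induction j, hj using Nat.le_induction with
  | base => exact le_rfl
  | succ j hj ih => rw [h_succ hj]; omega

theorem mem_shift {X : Finset (ℕ × ℕ)} {o x y : ℕ} :
    (x, y) ∈ shift X o ↔ ∃ x' y', (x', y') ∈ X ∧ x = x' + o ∧ y = y' + o := by
  simp only [shift, Finset.mem_image, Prod.mk.injEq, Prod.exists]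
  constructor
  · rintro ⟨a, b, h1, h2, h3⟩
    exact ⟨a, b, h1, h2.symm, h3.symm⟩
  · rintro ⟨a, b, h1, h2, h3⟩
    exact ⟨a, b, h1, h2.symm, h3.symm⟩

theorem mem_nested_succ {j x y : ℕ} (hj : 1 ≤ j) :
    (x, y) ∈ nested (j + 1) ↔ (x = 1 ∧ y = h (j + 1)) ∨
      (∃ x' y', (x', y') ∈ nested j ∧ x = x' + 1 ∧ y = y' + 1) ∨
      (∃ x' y', (x', y') ∈ nested j ∧ x = x' + (h j + 1) ∧ y = y' + (h j + 1)) := by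
  obtain ⟨j, rfl⟩ := Nat.exists_eq_add_of_le' hj
  rw [← mem_shift, ← mem_shift]
  simp [nested]

theorem nested_bounds {j : ℕ} (hj : 1 ≤ j) :
    ∀ x y, (x, y) ∈ nested j → 1 ≤ x ∧ x < y ∧ y ≤ h j := by
  induction j, hj using Nat.le_induction with
  | base =>
    intro x y hxy
    simp only [nested, Finset.mem_singleton, Prod.mk.injEq] at hxy
    simp [h, hxy]
  | succ j hj ih =>
    intro x y hxy
    have := h_succ hj
    have h3 := three_le_h hj
    rcases (mem_nested_succ hj).1 hxy with ⟨h1, h2⟩ | ⟨x', y', h0, h1, h2⟩ | ⟨x', y', h0, h1, h2⟩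
    · omega
    · have := ih _ _ h0
      omega
    · have := ih _ _ h0
      omega

theorem nested_outer {j : ℕ} (hj : 1 ≤ j) : (1, h j) ∈ nested j := by
  induction j, hj using Nat.le_induction with
  | base => simp [nested, h]
  | succ j hj ih => exact (mem_nested_succ hj).2 (Or.inl ⟨rfl, rfl⟩)

/-- The two shifted copies occupy depths strictly between the first and the last one, so only the
outer interval touches either end. -/
theorem nested_ends {j : ℕ} (hj : 1 ≤ j) {x y : ℕ} (hxy : (x, y) ∈ nested j) :
    x = 1 ↔ y = h j := by
  rcases Nat.lt_or_ge 1 j with hj' | hj'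
  · obtain ⟨j, rfl⟩ := Nat.exists_eq_add_of_le' hj
    have hj : 1 ≤ j := by omega
    have := h_succ hj
    have h3 := three_le_h hj
    rcases (mem_nested_succ hj).1 hxy with ⟨h1, h2⟩ | ⟨x', y', h0, h1, h2⟩ | ⟨x', y', h0, h1, h2⟩
    · omega
    · have := nested_bounds hj _ _ h0
      omega
    · have := nested_bounds hj _ _ h0
      omega
  · obtain rfl : j = 1 := by omega
    simp only [nested, Finset.mem_singleton, Prod.mk.injEq] at hxy
    simp [h, hxy]

/-- The outer interval and the two copies have their right ends in disjoint ranges, so equal right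
ends reduce to the same copy. Consequently a node receives ribs from at most one ancestor, which is
what degeneracy needs. -/
theorem nested_left_unique {j : ℕ} (hj : 1 ≤ j) :
    ∀ x x' y, (x, y) ∈ nested j → (x', y) ∈ nested j → x = x' := by
  induction j, hj using Nat.le_induction with
  | base =>
    intro x x' y hxy hxy'
    simp only [nested, Finset.mem_singleton, Prod.mk.injEq] at hxy hxy'
    omega
  | succ j hj ih =>
    intro x x' y hxy hxy'
    have := h_succ hj
    have h3 := three_le_h hj
    rcases (mem_nested_succ hj).1 hxy with ⟨h1, h2⟩ | ⟨a, b, h0, h1, h2⟩ | ⟨a, b, h0, h1, h2⟩ <;>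
    rcases (mem_nested_succ hj).1 hxy' with
      ⟨h1', h2'⟩ | ⟨a', b', h0', h1', h2'⟩ | ⟨a', b', h0', h1', h2'⟩
    · omega
    · have := nested_bounds hj _ _ h0'
      omega
    · have := nested_bounds hj _ _ h0'
      omega
    · have := nested_bounds hj _ _ h0
      omega
    · obtain rfl : b = b' := by omega
      have := ih _ _ _ h0 h0'
      omega
    · have := nested_bounds hj _ _ h0
      have := nested_bounds hj _ _ h0'
      omega
    · have := nested_bounds hj _ _ h0
      omega
    · have := nested_bounds hj _ _ h0
      have := nested_bounds hj _ _ h0'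
      omega
    · obtain rfl : b = b' := by omega
      have := ih _ _ _ h0 h0'
      omega

/-- Between the depths `o + 1` and `o + h j`, the system `nested l` is a copy of `nested j`. -/
def LevelAt (l o j : ℕ) : Prop :=
  ∀ x y, o < x → y ≤ o + h j → ((x, y) ∈ nested l ↔ (x, y) ∈ shift (nested j) o)

theorem levelAt_zero {l : ℕ} : LevelAt l 0 l := by
  intro x y _ _
  rw [mem_shift]
  exact ⟨fun hxy => ⟨x, y, hxy, rfl, rfl⟩, by rintro ⟨x', y', hxy, rfl, rfl⟩; exact hxy⟩

/-- The depths of a level `j + 1` split as `1 + h j + h j + 1`: root, first layer, second layer,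
deepest nodes. The first layer starts at offset `o + 1` and the second at `o + 1 + h j`; neither the
outer interval nor an interval of the other copy fits into its range. -/
theorem LevelAt.first {l o j : ℕ} (hj : 1 ≤ j) (hl : LevelAt l o (j + 1)) :
    LevelAt l (o + 1) j := by
  intro x y hx hy
  have := h_succ hj
  have := three_le_h hj
  rw [hl x y (by omega) (by omega), mem_shift, mem_shift]
  constructor
  · rintro ⟨x', y', hxy, rfl, rfl⟩
    rcases (mem_nested_succ hj).1 hxy with ⟨h1, h2⟩ | ⟨a, b, h0, h1, h2⟩ | ⟨a, b, h0, h1, h2⟩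
    · omega
    · exact ⟨a, b, h0, by omega, by omega⟩
    · have := nested_bounds hj _ _ h0
      omega
  · rintro ⟨a, b, h0, rfl, rfl⟩
    exact ⟨a + 1, b + 1, (mem_nested_succ hj).2 (Or.inr (Or.inl ⟨a, b, h0, rfl, rfl⟩)),
      by omega, by omega⟩

theorem LevelAt.second {l o j : ℕ} (hj : 1 ≤ j) (hl : LevelAt l o (j + 1)) :
    LevelAt l (o + 1 + h j) j := by
  intro x y hx hy
  have := h_succ hj
  have := three_le_h hj
  rw [hl x y (by omega) (by omega), mem_shift, mem_shift]
  constructor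
  · rintro ⟨x', y', hxy, rfl, rfl⟩
    rcases (mem_nested_succ hj).1 hxy with ⟨h1, h2⟩ | ⟨a, b, h0, h1, h2⟩ | ⟨a, b, h0, h1, h2⟩
    · omega
    · have := nested_bounds hj _ _ h0
      omega
    · exact ⟨a, b, h0, by omega, by omega⟩
  · rintro ⟨a, b, h0, rfl, rfl⟩
    exact ⟨a + (h j + 1), b + (h j + 1),
      (mem_nested_succ hj).2 (Or.inr (Or.inr ⟨a, b, h0, rfl, rfl⟩)), by omega, by omega⟩

theorem LevelAt.outer {l o j : ℕ} (hj : 1 ≤ j) (hl : LevelAt l o j) :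
    (o + 1, o + h j) ∈ nested l := by
  rw [hl _ _ (by omega) (by omega), mem_shift]
  exact ⟨1, h j, nested_outer hj, by omega, by omega⟩

theorem LevelAt.ends {l o j x y : ℕ} (hj : 1 ≤ j) (hl : LevelAt l o j) (hx : o < x)
    (hy : y ≤ o + h j) (hxy : (x, y) ∈ nested l) : x = o + 1 ↔ y = o + h j := by
  rw [hl _ _ hx hy, mem_shift] at hxy
  obtain ⟨x', y', h0, rfl, rfl⟩ := hxy
  have := nested_ends hj h0
  omega

/-- No interval inside a level crosses the depths that separate the parts of the level. -/
theorem LevelAt.not_cross {l o j x y : ℕ} (hj : 1 ≤ j) (hl : LevelAt l o (j + 1)) (hx : o + 1 < x)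
    (hy : y ≤ o + h (j + 1)) (hxy : (x, y) ∈ nested l) :
    y ≤ o + 1 + h j ∨ (o + 1 + h j < x ∧ y ≤ o + 1 + 2 * h j) := by
  rw [hl _ _ (by omega) hy, mem_shift] at hxy
  obtain ⟨x', y', h0, rfl, rfl⟩ := hxy
  rcases (mem_nested_succ hj).1 h0 with ⟨h1, h2⟩ | ⟨a, b, h0, h1, h2⟩ | ⟨a, b, h0, h1, h2⟩
  · omega
  · have := nested_bounds hj _ _ h0
    omega
  · have := nested_bounds hj _ _ h0
    omega

/-! ### Cutting an induced path at a depth -/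

/-- Along a path all of whose words have length at least `δ`, and that uses only edges between
comparable words, the prefix of the words towards the root of length `δ` is constant. -/
theorem exists_common_suffix {w : ℤ → List Bool} {δ : ℕ} {i k : ℤ} (hik : i ≤ k)
    (hlen : ∀ m, i ≤ m → m ≤ k → δ ≤ (w m).length)
    (hstep : ∀ m, i ≤ m → m + 1 ≤ k → w m <:+ w (m + 1) ∨ w (m + 1) <:+ w m) :
    ∃ d : List Bool, d.length = δ ∧ ∀ m, i ≤ m → m ≤ k → d <:+ w m := by
  refine ⟨(w i).drop ((w i).length - δ), ?_, ?_⟩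
  · have := hlen i le_rfl hik
    rw [List.length_drop]
    omega
  · have hd : ((w i).drop ((w i).length - δ)).length = δ := by
      have := hlen i le_rfl hik
      rw [List.length_drop]
      omega
    intro m hm
    induction m, hm using Int.leInduction with
    | base => exact fun _ => List.drop_suffix _ _
    | succ m hm ih =>
      intro hmk
      have h1 := ih (by omega)
      rcases hstep m hm hmk with h2 | h2
      · exact h1.trans h2
      · exact List.suffix_of_suffix_length_le h1 h2
          (by rw [hd]; exact hlen (m + 1) (by omega) hmk)

section Cut

variable {l : ℕ} {c : Choices (h l)} {f : ℤ → Vertex (h l)} {i k : ℤ} {δ : ℕ}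

/-- No rib between vertices of the path leads from words of length less than `δ` to words of length
at least `δ`. -/
def NoCross (c : Choices (h l)) (f : ℤ → Vertex (h l)) (i k : ℤ) (δ : ℕ) : Prop :=
  ∀ a b, i ≤ a → a ≤ k → i ≤ b → b ≤ k → RibStep c (nested l) (f a) (f b) →
    (f a).word.length < δ → (f b).word.length < δ

theorem adj_comparable {u v : Vertex (h l)} (huv : (ribbedGraph l c).Adj u v) :
    u.word <:+ v.word ∨ v.word <:+ u.word := by
  rcases adj_cases huv with h1 | h1 | h1 | h1 | h1
  · exact Or.inl (by rw [h1])
  · exact Or.inl h1.suffix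
  · exact Or.inr h1.suffix
  · exact Or.inl h1.2.2.1
  · exact Or.inr h1.2.2.1

theorem IndPath.exists_branch (hf : IndPath (ribbedGraph l c) f i k) {a b : ℤ} (ha : i ≤ a)
    (hb : b ≤ k) (hab : a ≤ b) (hlen : ∀ m, a ≤ m → m ≤ b → δ ≤ (f m).word.length) :
    ∃ d : List Bool, d.length = δ ∧ ∀ m, a ≤ m → m ≤ b → d <:+ (f m).word :=
  exists_common_suffix (w := fun m => (f m).word) hab hlen fun m hm hmb =>
    adj_comparable (hf.adj_succ (a := m) (by omega) (by omega) rfl)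

/-- A step of the path across the threshold `δ` follows a tree edge. -/
theorem NoCross.treeStep (hc : NoCross c f i k δ) {a b : ℤ} (h1 : i ≤ a) (h2 : a ≤ k) (h3 : i ≤ b)
    (h4 : b ≤ k) (hab : (ribbedGraph l c).Adj (f a) (f b)) (ha : (f a).word.length < δ)
    (hb : δ ≤ (f b).word.length) : TreeStep (f a) (f b) := by
  rcases adj_cases hab with h | h | h | h | h
  · rw [h] at ha
    omega
  · exact h
  · have := h.length
    omega
  · have := hc _ _ h1 h2 h3 h4 h ha
    omega
  · have := h.2.2.2.1
    omega

/-- An excursion beyond depth `δ` stays in one branch and both enters and leaves it by a tree edge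
at its topmost node. The two outer ends then lie in the triangle of the same parent, hence are equal
or adjacent, which an induced path with vertices in between forbids. -/
theorem IndPath.no_return (hf : IndPath (ribbedGraph l c) f i k) (hc : NoCross c f i k δ)
    {a b m : ℤ} (h1 : i ≤ a) (h2 : a ≤ m) (h3 : m ≤ b) (h4 : b ≤ k)
    (ha : (f a).word.length < δ) (hb : (f b).word.length < δ) : (f m).word.length < δ := by
  by_contra hm
  obtain ⟨p, hp1, hp2, hp3, hp4⟩ :=
    exists_last (Q := fun n => (f n).word.length < δ) h2 ha
  obtain ⟨q, hq1, hq2, hq3, hq4⟩ :=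
    exists_first (Q := fun n => (f n).word.length < δ) h3 hb
  have hpm : p ≠ m := by
    rintro rfl
    exact hm hp3
  have hqm : q ≠ m := by
    rintro rfl
    exact hm hq3
  have hge : ∀ n, p + 1 ≤ n → n ≤ q - 1 → δ ≤ (f n).word.length := by
    intro n hn1 hn2
    rcases le_total n m with hnm | hnm
    · exact not_lt.1 (hp4 n (by omega) hnm)
    · exact not_lt.1 (hq4 n hnm (by omega))
  obtain ⟨d, hd, hdw⟩ := hf.exists_branch (a := p + 1) (b := q - 1) (by omega) (by omega)
    (by omega) hge
  have t1 : TreeStep (f p) (f (p + 1)) := hc.treeStep (by omega) (by omega) (by omega) (by omega)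
    (hf.adj_succ (by omega) (by omega) rfl) hp3 (hge _ (by omega) (by omega))
  have t2 : TreeStep (f q) (f (q - 1)) := hc.treeStep (by omega) (by omega) (by omega) (by omega)
    (hf.adj_succ (a := q - 1) (b := q) (by omega) (by omega) (by omega)).symm hq3
    (hge _ (by omega) (by omega))
  -- Both inner ends have length exactly `δ`, so both words equal the common suffix `d`.
  have hw : (f (p + 1)).word = (f (q - 1)).word := by
    have e1 := t1.length
    have e2 := t2.length
    have e3 := hge (p + 1) (by omega) (by omega)
    have e4 := hge (q - 1) (by omega) (by omega)
    rw [← (hdw (p + 1) (by omega) (by omega)).eq_of_length (by omega),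
      ← (hdw (q - 1) (by omega) (by omega)).eq_of_length (by omega)]
  obtain ⟨c1, -, b1, hb1⟩ := t1
  obtain ⟨c2, -, b2, hb2⟩ := t2
  rw [hb1, hb2] at hw
  have := hf.clique_le (a := p) (b := q) (by omega) (by omega) c1 c2 (List.cons.inj hw).2
  omega

/-- The part of the path between `a` and `b` lies in the subtree of the node `d` of depth `δ + 1`,
enters it at `b`, and the vertex at `b'` is its neighbour outside. -/
def Branch (f : ℤ → Vertex (h l)) (δ : ℕ) (lo hi b b' : ℤ) : Prop :=
  ∃ d : List Bool, d.length = δ ∧ (∀ m, lo ≤ m → m ≤ hi → d <:+ (f m).word) ∧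
    (f b).IsTop ∧ (f b).word = d ∧ (f b').IsClique ∧ (f b').word.length + 1 = δ

theorem IndPath.branch (hf : IndPath (ribbedGraph l c) f i k) (hc : NoCross c f i k δ)
    {lo hi b b' : ℤ} (h1 : i ≤ lo) (h2 : hi ≤ k) (h3 : lo ≤ b) (h4 : b ≤ hi)
    (h5 : i ≤ b') (h6 : b' ≤ k) (hadj : (ribbedGraph l c).Adj (f b') (f b))
    (hb' : (f b').word.length < δ) (hlen : ∀ m, lo ≤ m → m ≤ hi → δ ≤ (f m).word.length) :
    Branch f δ lo hi b b' := by
  obtain ⟨d, hd, hdw⟩ := hf.exists_branch h1 h2 (by omega) hlen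
  have t := hc.treeStep h5 h6 (by omega) (by omega) hadj hb' (hlen b h3 h4)
  have e1 := t.length
  have e2 := hlen b h3 h4
  exact ⟨d, hd, hdw, t.2.1, ((hdw b h3 h4).eq_of_length (by omega)).symm, t.1, by omega⟩

/-- A path that crosses depth `δ` only along tree edges lies below that depth, or it consists of a
part above that depth, preceded and followed by parts in one branch each. -/
theorem IndPath.cut (hf : IndPath (ribbedGraph l c) f i k) (hik : i ≤ k)
    (hc : NoCross c f i k δ) :
    (∃ d : List Bool, d.length = δ ∧ ∀ m, i ≤ m → m ≤ k → d <:+ (f m).word) ∨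
    ∃ i' k', i ≤ i' ∧ i' ≤ k' ∧ k' ≤ k ∧
      (∀ m, i' ≤ m → m ≤ k' → (f m).word.length < δ) ∧
      (i < i' → Branch f δ i (i' - 1) (i' - 1) i') ∧
      (k' < k → Branch f δ (k' + 1) k (k' + 1) k') := by
  by_cases hall : ∀ m, i ≤ m → m ≤ k → δ ≤ (f m).word.length
  · exact Or.inl (hf.exists_branch le_rfl le_rfl hik hall)
  push Not at hall
  obtain ⟨m, hm1, hm2, hm3⟩ := hall
  obtain ⟨p, hp1, hp2, hp3, hp4⟩ :=
    exists_first (Q := fun n => (f n).word.length < δ) hm1 hm3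
  obtain ⟨q, hq1, hq2, hq3, hq4⟩ :=
    exists_last (Q := fun n => (f n).word.length < δ) hm2 hm3
  refine Or.inr ⟨p, q, hp1, by omega, hq2, fun n hn1 hn2 =>
    hf.no_return hc hp1 hn1 hn2 hq2 hp3 hq3, fun hip => ?_, fun hqk => ?_⟩
  · exact hf.branch hc le_rfl (by omega) (by omega) le_rfl (by omega) (by omega)
      (hf.adj_succ (a := p - 1) (b := p) (by omega) (by omega) (by omega)).symm hp3
      fun n hn1 hn2 => not_lt.1 (hp4 n hn1 (by omega))
  · exact hf.branch hc (by omega) le_rfl le_rfl (by omega) (by omega) (by omega)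
      (hf.adj_succ (by omega) (by omega) rfl) hq3
      fun n hn1 hn2 => not_lt.1 (hq4 n (by omega) hn2)

end Cut

/-! ### Induced paths inside one level -/

section Zone

variable {l : ℕ} {c : Choices (h l)} {f : ℤ → Vertex (h l)} {i k : ℤ} {r : List Bool} {j : ℕ}

/-- An induced path whose vertices belong to nodes below `r`, at most `h j - 1` levels deeper. -/
structure ZonePath (c : Choices (h l)) (r : List Bool) (j : ℕ) (f : ℤ → Vertex (h l))
    (i k : ℤ) : Prop where
  path : IndPath (ribbedGraph l c) f i k
  suffix : ∀ m, i ≤ m → m ≤ k → r <:+ (f m).word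
  length_lt : ∀ m, i ≤ m → m ≤ k → (f m).word.length < r.length + h j

/-- `v` is in the triangle of one of the deepest nodes of the level `j` with root `r`. -/
def AtLeaf (r : List Bool) (j : ℕ) (v : Vertex (h l)) : Prop :=
  v.IsClique ∧ v.word.length + 1 = r.length + h j

/-- `v` is a top-predecessor of `r`. -/
def AtTop (r : List Bool) (v : Vertex (h l)) : Prop :=
  v.IsTop ∧ v.word = r

theorem ZonePath.mono {i' k' : ℤ} (hz : ZonePath c r j f i k) (hi : i ≤ i') (hk : k' ≤ k) :
    ZonePath c r j f i' k' :=
  ⟨hz.path.mono hi hk, fun m h1 h2 => hz.suffix m (hi.trans h1) (h2.trans hk),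
    fun m h1 h2 => hz.length_lt m (hi.trans h1) (h2.trans hk)⟩

theorem ZonePath.reverse (hz : ZonePath c r j f i k) :
    ZonePath c r j (fun m => f (-m)) (-k) (-i) :=
  ⟨hz.path.reverse, fun m h1 h2 => hz.suffix (-m) (by omega) (by omega),
    fun m h1 h2 => hz.length_lt (-m) (by omega) (by omega)⟩

theorem ZonePath.le_length (hz : ZonePath c r j f i k) {m : ℤ} (h1 : i ≤ m) (h2 : m ≤ k) :
    r.length ≤ (f m).word.length :=
  (hz.suffix m h1 h2).length_le

theorem ZonePath.lt_length (hz : ZonePath c r j f i k) {m : ℤ} (h1 : i ≤ m) (h2 : m ≤ k)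
    (h3 : (f m).word ≠ r) : r.length < (f m).word.length :=
  suffix_ne_length (hz.suffix m h1 h2) h3.symm

/-! #### Paths in few nodes are short -/

theorem IndPath.le_card {V α : Type*} {G : SimpleGraph V} {f : ℤ → V} {i k : ℤ}
    (hf : IndPath G f i k) (g : V → α) (S : Finset α) (hS : ∀ m, i ≤ m → m ≤ k → g (f m) ∈ S)
    (hg : ∀ a b, i ≤ a → a ≤ k → i ≤ b → b ≤ k → g (f a) = g (f b) → f a = f b) :
    k - i + 1 ≤ S.card := by
  have := Finset.card_le_card_of_injOn (s := Finset.Icc i k) (t := S) (fun m => g (f m))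
    (fun m hm => by
      have := Finset.mem_Icc.1 hm
      exact hS m this.1 this.2)
    (fun a ha b hb hab => by
      have ha := Finset.mem_Icc.1 ha
      have hb := Finset.mem_Icc.1 hb
      have hfab := hg a b ha.1 ha.2 hb.1 hb.2 hab
      rcases lt_trichotomy a b with hlt | heq | hlt
      · exact absurd hfab (hf a b ha.1 hlt hb.2).1
      · exact heq
      · exact absurd hfab.symm (hf b a hb.1 hlt ha.2).1)
  rw [Int.card_Icc] at this
  omega

/-- A numbering of the at most seven vertices of each node. -/
def Vertex.code {p : ℕ} : Vertex p → Fin 3 × Bool × Bool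
  | .clique _ i => (i, false, false)
  | .top _ _ side => (0, true, side)
  | .bot _ _ side => (1, true, side)

/-- The possible values of `Vertex.code`. -/
def codes : Finset (Fin 3 × Bool × Bool) :=
  {(0, false, false), (1, false, false), (2, false, false), (0, true, false), (0, true, true),
    (1, true, false), (1, true, true)}

theorem Vertex.code_mem {p : ℕ} (v : Vertex p) : v.code ∈ codes := by
  rcases v with ⟨s, i⟩ | ⟨t, ht, side⟩ | ⟨t, ht, side⟩
  · revert i
    simp only [Vertex.code]
    decide
  · revert side
    simp only [Vertex.code]
    decide
  · revert side
    simp only [Vertex.code]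
    decide

theorem Vertex.ext_code {p : ℕ} {u v : Vertex p} (hw : u.word = v.word) (hc : u.code = v.code) :
    u = v := by
  cases u <;> cases v <;> simp_all [Vertex.code, Vertex.word, Subtype.ext_iff]

theorem IndPath.node_le {d : List Bool} (hf : IndPath (ribbedGraph l c) f i k)
    (hd : ∀ m, i ≤ m → m ≤ k → (f m).word = d) : k - i ≤ 6 := by
  have := hf.le_card Vertex.code codes (fun m _ _ => (f m).code_mem)
    (fun a b h1 h2 h3 h4 hab => Vertex.ext_code ((hd a h1 h2).trans (hd b h3 h4).symm) hab)
  have h7 : codes.card = 7 := by decide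
  omega

/-- The binary words of length at most `2`. -/
def shortWords : Finset (List Bool) :=
  {[], [false], [true], [false, false], [false, true], [true, false], [true, true]}

theorem mem_shortWords {w : List Bool} (hw : w.length < 3) : w ∈ shortWords := by
  rcases w with _ | ⟨a, _ | ⟨b, _ | ⟨x, w⟩⟩⟩
  · decide
  · revert a
    decide
  · revert a b
    decide
  · simp only [List.length_cons] at hw
    omega

/-- A level `1` has seven nodes with at most seven vertices each, so a path in it has at most `49`
vertices. -/
theorem ZonePath.base_le (hz : ZonePath c r 1 f i k) : k - i ≤ 48 := by
  -- A word below `r` is recovered from its part in front of `r`, so this part and the code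
  -- determine the vertex.
  have hex : ∀ m, i ≤ m → m ≤ k →
      (f m).word.take ((f m).word.length - r.length) ++ r = (f m).word := by
    intro m h1 h2
    obtain ⟨e, he⟩ := hz.suffix m h1 h2
    rw [← he]
    simp
  have := hz.path.le_card
    (fun v => (v.word.take (v.word.length - r.length), v.code)) (shortWords ×ˢ codes)
    (fun m h1 h2 => Finset.mem_product.2 ⟨mem_shortWords (by
      have h3 := hz.length_lt m h1 h2
      rw [show h 1 = 3 from rfl] at h3
      rw [List.length_take]
      omega), (f m).code_mem⟩)
    (fun a b h1 h2 h3 h4 hab => by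
      obtain ⟨hab1, hab2⟩ := Prod.mk.inj hab
      refine Vertex.ext_code ?_ hab2
      rw [← hex a h1 h2, ← hex b h3 h4, hab1])
  have h49 : (shortWords ×ˢ codes).card = 49 := by
    rw [Finset.card_product]
    decide
  omega

/-! #### The root of a level -/

theorem ZonePath.leave (hz : ZonePath c r j f i k) {a b : ℤ} (h3 : i ≤ b) (h4 : b ≤ k)
    (hab : (ribbedGraph l c).Adj (f a) (f b)) (ha : (f a).word = r)
    (hb : (f b).word ≠ r) : TreeStep (f a) (f b) ∨ RibStep c (nested l) (f a) (f b) := by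
  have hlt := hz.lt_length h3 h4 hb
  rcases adj_cases hab with h | h | h | h | h
  · exact absurd (h.symm.trans ha) hb
  · exact Or.inl h
  · have := h.length
    rw [ha] at this
    omega
  · exact Or.inr h
  · have := h.2.2.2.1
    rw [ha] at this
    omega

/-- Inside the zone the root node can be left and re-entered only through its triangle, and two
vertices of one triangle cannot be the ends of a longer excursion of an induced path. -/
theorem ZonePath.root_interval (hz : ZonePath c r j f i k) {a b m : ℤ} (h1 : i ≤ a) (h2 : a ≤ m)
    (h3 : m ≤ b) (h4 : b ≤ k) (ha : (f a).word = r) (hb : (f b).word = r) : (f m).word = r := by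
  by_contra hm
  obtain ⟨p, hp1, hp2, hp3, hp4⟩ := exists_last (Q := fun n => (f n).word = r) h2 ha
  obtain ⟨q, hq1, hq2, hq3, hq4⟩ := exists_first (Q := fun n => (f n).word = r) h3 hb
  have hpm : p ≠ m := by
    rintro rfl
    exact hm hp3
  have hqm : q ≠ m := by
    rintro rfl
    exact hm hq3
  have c1 : (f p).IsClique := by
    rcases hz.leave (a := p) (b := p + 1) (by omega) (by omega)
      (hz.path.adj_succ (by omega) (by omega) rfl) hp3 (hp4 _ (by omega) (by omega)) with h | h
    · exact h.1
    · exact h.1.isClique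
  have c2 : (f q).IsClique := by
    rcases hz.leave (a := q) (b := q - 1) (by omega) (by omega)
      (hz.path.adj_succ (a := q - 1) (b := q) (by omega) (by omega) (by omega)).symm hq3
      (hq4 _ (by omega) (by omega)) with h | h
    · exact h.1
    · exact h.1.isClique
  have := hz.path.clique_le (a := p) (b := q) (by omega) (by omega) c1 c2 (hp3.trans hq3.symm)
  omega

theorem ZonePath.root_le (hz : ZonePath c r j f i k) {a b : ℤ} (h1 : i ≤ a) (h4 : b ≤ k)
    (ha : (f a).word = r) (hb : (f b).word = r) : b - a ≤ 6 :=
  (hz.path.mono h1 h4).node_le fun _ h2 h3 => hz.root_interval h1 h2 h3 h4 ha hb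

/-! #### Paths between the root and a leaf of a level -/

/-- The last steps into the triangle of the leaf `t` pass through a bottom-predecessor `y` of `t`.
Before `y` comes either the top-predecessor on the same side, and then the vertex at `q` sees one of
the two, or the upper end of a rib, and then this end lies in the triangle of `r` together with the
vertex at `q`. Inducedness leaves only a few steps in both cases. -/
theorem ZonePath.topEdge_leaf_le (hj : 1 ≤ j) (hl : LevelAt l r.length j)
    (hz : ZonePath c r j f i k) {q n : ℤ} (hq : i ≤ q) (hqn : q ≤ n) (hn : n ≤ k)
    (htop : (f q).OnTopEdge c) (hr : (f q).word = r) (hleaf : AtLeaf r j (f n)) : n ≤ q + 4 := by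
  have h3 := three_le_h hj
  obtain ⟨m, hm1, hm2, ⟨hm3, hm4⟩, hm5⟩ :=
    exists_first (Q := fun m => (f m).IsClique ∧ (f m).word = (f n).word) hqn ⟨hleaf.1, rfl⟩
  have hmn := hz.path.clique_le (a := m) (b := n) (by omega) hn hm3 hleaf.1 hm4
  have hleafm : (f m).word.length + 1 = r.length + h j := by rw [hm4]; exact hleaf.2
  have hqm : q ≠ m := by
    rintro rfl
    rw [hr] at hleafm
    omega
  have a1 := hz.path.adj_succ (a := m - 1) (b := m) (by omega) (by omega) (by omega)
  have l1 := hz.length_lt (m - 1) (by omega) (by omega)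
  -- Children of a leaf are outside the zone and ribs down from the leaf would leave it too; the
  -- choice of `m` excludes a preceding vertex of the same triangle.
  have b1 : (f (m - 1)).IsBot ∧ (f (m - 1)).word = (f m).word := by
    rcases adj_cases a1 with e | e | e | e | e
    · refine ⟨?_, e⟩
      rcases adj_same_word a1 e with e' | e' | e' | e' | e'
      · exact absurd ⟨e'.1, e.trans hm4⟩ (hm5 (m - 1) (by omega) (by omega))
      · exact absurd hm3 e'.2.not_isClique
      · exact absurd hm3 e'.2.not_isClique
      · exact e'.1
      · exact absurd hm3 e'.2.not_isClique
    · exact absurd hm3 e.2.1.not_isClique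
    · have := e.length
      omega
    · exact absurd hm3 e.2.1
    · have := e.2.2.2.1
      omega
  have hqm1 : q ≠ m - 1 := by
    rintro rfl
    exact b1.1.not_isClique htop.isClique
  have a2 := hz.path.adj_succ (a := m - 2) (b := m - 1) (by omega) (by omega) (by omega)
  have l2 := hz.length_lt (m - 2) (by omega) (by omega)
  rcases adj_cases a2 with e | e | e | e | e
  · rcases adj_same_word a2 e with e' | e' | e' | e' | e'
    · exact absurd e'.2 fun hb => b1.1.not_isClique hb
    · have hqlt : q < m - 2 := by
        rcases lt_or_eq_of_le (show q ≤ m - 2 by omega) with hh | hh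
        · exact hh
        · rw [← hh] at e'
          exact absurd htop.isClique e'.1.not_isClique
      have hw : (f (m - 2)).word = (f m).word := e.trans b1.2
      rcases adj_pred_of_onTopEdge htop e'.1 e'.2 e
        (by rw [hr]; exact hz.suffix _ (by omega) (by omega))
        (by rw [hr, hw]; omega)
        (by rw [hr, hw, hleafm]; exact hl.outer hj) with hadj | hadj
      · have := (hz.path q (m - 2) hq hqlt (by omega)).2.1 hadj
        omega
      · have := (hz.path q (m - 1) hq (by omega) (by omega)).2.1 hadj
        omega
    · exact absurd e'.2 b1.1.not_isTop
    · exact absurd e'.2.isClique b1.1.not_isClique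
    · exact absurd ⟨e'.1.isClique, e.trans (b1.2.trans hm4)⟩ (hm5 (m - 2) (by omega) (by omega))
  · exact absurd e.2.1 b1.1.not_isTop
  · exact absurd e.1 b1.1.not_isClique
  -- A rib ending at the last depth of the level belongs to the outer interval, so it starts at `r`.
  · have hN := e.2.2.2.2
    have hle := hz.le_length (m := m - 2) (by omega) (by omega)
    have := (hl.ends hj (by omega) (by rw [b1.2]; omega) hN).2 (by rw [b1.2]; omega)
    have hw : (f (m - 2)).word = r :=
      ((hz.suffix (m - 2) (by omega) (by omega)).eq_of_length (by omega)).symm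
    have := hz.path.clique_le (a := q) (b := m - 2) hq (by omega) htop.isClique e.1.isClique
      (hr.trans hw.symm)
    omega
  · exact absurd e.1.isClique b1.1.not_isClique

/-- From a top-predecessor of `r` the zone allows only the step to the bottom-predecessor on the
same side. That vertex has no second top-predecessor to go to, so the path continues on the top edge
of `K^r`, where `ZonePath.topEdge_leaf_le` applies. -/
theorem ZonePath.top_leaf_le (hj : 1 ≤ j) (hl : LevelAt l r.length j)
    (hz : ZonePath c r j f i k) (htop : AtTop r (f i)) (hleaf : AtLeaf r j (f k)) :
    k - i ≤ 6 := by
  have h3 := three_le_h hj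
  by_contra hlong
  have a1 := hz.path.adj_succ (a := i) (b := i + 1) le_rfl (by omega) rfl
  have a2 := hz.path.adj_succ (a := i + 1) (b := i + 2) (by omega) (by omega) (by omega)
  have b1 : (f (i + 1)).IsBot ∧ (f (i + 1)).word = r := by
    by_cases hw : (f (i + 1)).word = r
    · refine ⟨?_, hw⟩
      rcases adj_same_word a1 (htop.2.trans hw.symm) with e | e | e | e | e
      · exact absurd e.1 htop.1.not_isClique
      · exact e.2
      · exact absurd htop.1 e.1.not_isTop
      · exact absurd htop.1 e.1.not_isTop
      · exact e.2
    · rcases hz.leave (by omega) (by omega) a1 htop.2 hw with e | e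
      · exact absurd e.1 htop.1.not_isClique
      · exact absurd e.1.isClique htop.1.not_isClique
  have b2 : (f (i + 2)).OnTopEdge c ∧ (f (i + 2)).word = r := by
    by_cases hw : (f (i + 2)).word = r
    · refine ⟨?_, hw⟩
      rcases adj_same_word a2 (b1.2.trans hw.symm) with e | e | e | e | e
      · exact absurd e.1 b1.1.not_isClique
      · exact absurd e.1 b1.1.not_isTop
      · exact absurd (eq_of_adj_bot htop.1 e.2 b1.1 a1 a2.symm)
          (hz.path i (i + 2) le_rfl (by omega) (by omega)).1
      · exact e.2
      · exact absurd e.1.isClique b1.1.not_isClique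
    · rcases hz.leave (by omega) (by omega) a2 b1.2 hw with e | e
      · exact absurd e.1 b1.1.not_isClique
      · exact absurd e.1.isClique b1.1.not_isClique
  have := hz.topEdge_leaf_le hj hl (q := i + 2) (n := k) (by omega) (by omega) le_rfl b2.1 b2.2
    hleaf
  omega

end Zone

/-! ### Decomposition of the paths that avoid the root of a level -/

section Decomposition

variable {l : ℕ} {c : Choices (h l)} {f : ℤ → Vertex (h l)} {i k : ℤ} {r : List Bool} {j : ℕ}

/-- Only the outer interval crosses the boundaries of the layers, and its ribs start at the root,
which the path avoids. -/
theorem ZonePath.noCross (hj : 1 ≤ j) (hl : LevelAt l r.length (j + 1))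
    (hz : ZonePath c r (j + 1) f i k) (hr : ∀ m, i ≤ m → m ≤ k → (f m).word ≠ r) :
    NoCross c f i k (r.length + 1 + h j) ∧ NoCross c f i k (r.length + 1 + 2 * h j) := by
  have key : ∀ a b, i ≤ a → a ≤ k → i ≤ b → b ≤ k → RibStep c (nested l) (f a) (f b) →
      (f b).word.length + 1 ≤ r.length + 1 + h j ∨ (r.length + 1 + h j < (f a).word.length + 1 ∧
        (f b).word.length + 1 ≤ r.length + 1 + 2 * h j) := by
    intro a b h1 h2 h3 h4 hab
    have e1 := hz.lt_length h1 h2 (hr a h1 h2)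
    have e2 := hz.length_lt b h3 h4
    exact hl.not_cross hj (by omega) (by omega) hab.2.2.2.2
  constructor
  · intro a b h1 h2 h3 h4 hab ha
    have := key a b h1 h2 h3 h4 hab
    omega
  · intro a b h1 h2 h3 h4 hab ha
    have := key a b h1 h2 h3 h4 hab
    omega

/-- The part of the path from `lo` to `hi` lies in a deepest node of the level `j + 1` with root `r`,
and the vertex at `b` is in the triangle of a parent of such a node. -/
def LeafEnd (r : List Bool) (j : ℕ) (f : ℤ → Vertex (h l)) (lo hi b : ℤ) : Prop :=
  (∀ m, lo ≤ m → m ≤ hi → (f m).word.length + 1 = r.length + h (j + 1)) ∧ hi - lo ≤ 6 ∧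
    (f b).IsClique ∧ (f b).word.length + 1 = r.length + 1 + 2 * h j

/-- The part of the path from `lo` to `hi` lies in a level `j` of the second layer, which is entered
at `b` from the vertex at `b'` in a leaf of the level `j` with root `e`. -/
def LowerPart (c : Choices (h l)) (r e : List Bool) (j : ℕ) (f : ℤ → Vertex (h l))
    (lo hi b b' : ℤ) : Prop :=
  ∃ d : List Bool, d.length = r.length + 1 + h j ∧ ZonePath c d j f lo hi ∧ AtTop d (f b) ∧
    AtLeaf e j (f b')

theorem ZonePath.leafEnd (hj : 1 ≤ j) (hz : ZonePath c r (j + 1) f i k) {lo hi b b' : ℤ}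
    (h1 : i ≤ lo) (h2 : hi ≤ k) (hb : Branch f (r.length + 1 + 2 * h j) lo hi b b') :
    LeafEnd r j f lo hi b' := by
  obtain ⟨d, hd, hdw, -, -, hcl, hlen⟩ := hb
  have hs := h_succ hj
  have hw : ∀ m, lo ≤ m → m ≤ hi → (f m).word = d := by
    intro m h3 h4
    have h5 := hz.length_lt m (by omega) (by omega)
    have h6 := (hdw m h3 h4).length_le
    exact ((hdw m h3 h4).eq_of_length (by omega)).symm
  refine ⟨fun m h3 h4 => ?_, (hz.path.mono h1 h2).node_le hw, hcl, hlen⟩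
  rw [hw m h3 h4, hd]
  omega

/-- The path is cut above the deepest layer, and its middle part is cut again between the two layers
of sublevels. The alternatives say how high the path climbs: it stays in a deepest node, reaches the
second layer, or reaches the first layer. -/
theorem ZonePath.decomp (hj : 1 ≤ j) (hl : LevelAt l r.length (j + 1))
    (hz : ZonePath c r (j + 1) f i k) (hik : i ≤ k) (hr : ∀ m, i ≤ m → m ≤ k → (f m).word ≠ r) :
    k - i ≤ 6 ∨
    (∃ d i' k', d.length = r.length + 1 + h j ∧ i ≤ i' ∧ i' ≤ k' ∧ k' ≤ k ∧ ZonePath c d j f i' k' ∧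
      (i < i' → LeafEnd r j f i (i' - 1) i') ∧ (k' < k → LeafEnd r j f (k' + 1) k k')) ∨
    (∃ e i' i'' k'' k', e.length = r.length + 1 ∧ i ≤ i' ∧ i' ≤ i'' ∧ i'' ≤ k'' ∧ k'' ≤ k' ∧
      k' ≤ k ∧ ZonePath c e j f i'' k'' ∧
      (i < i' → LeafEnd r j f i (i' - 1) i' ∧ i' < i'') ∧
      (k' < k → LeafEnd r j f (k' + 1) k k' ∧ k'' < k') ∧
      (i' < i'' → LowerPart c r e j f i' (i'' - 1) (i'' - 1) i'') ∧
      (k'' < k' → LowerPart c r e j f (k'' + 1) k' (k'' + 1) k'')) := by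
  obtain ⟨hc1, hc2⟩ := hz.noCross hj hl hr
  have hs := h_succ hj
  have h3 := three_le_h hj
  rcases hz.path.cut hik hc2 with ⟨d, hd, hdw⟩ | ⟨i', k', hii, hik', hkk, hlen, hpre, hsuf⟩
  · left
    refine hz.path.node_le (d := d) fun m h4 h5 => ?_
    have h6 := hz.length_lt m h4 h5
    have h7 := (hdw m h4 h5).length_le
    exact ((hdw m h4 h5).eq_of_length (by omega)).symm
  right
  have hpre' : i < i' → LeafEnd r j f i (i' - 1) i' := fun hlt =>
    hz.leafEnd hj le_rfl (by omega) (hpre hlt)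
  have hsuf' : k' < k → LeafEnd r j f (k' + 1) k k' := fun hlt =>
    hz.leafEnd hj (by omega) le_rfl (hsuf hlt)
  have hz' := hz.mono hii hkk
  have hc1' : NoCross c f i' k' (r.length + 1 + h j) := fun a b h4 h5 h6 h7 =>
    hc1 a b (by omega) (by omega) (by omega) (by omega)
  rcases hz'.path.cut hik' hc1' with
    ⟨d, hd, hdw⟩ | ⟨i'', k'', hii', hik'', hkk', hlen', hlo, hhi⟩
  · left
    refine ⟨d, i', k', hd, hii, hik', hkk, ⟨hz'.path, hdw, fun m h4 h5 => ?_⟩, hpre', hsuf'⟩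
    have := hlen m h4 h5
    omega
  right
  obtain ⟨e, he, hew⟩ := hz'.path.exists_branch (δ := r.length + 1) hii' hkk' hik''
    fun m h4 h5 => hz.lt_length (by omega) (by omega) (hr m (by omega) (by omega))
  have hlow : ∀ lo hi b b', i' ≤ lo → hi ≤ k' → Branch f (r.length + 1 + h j) lo hi b b' →
      LowerPart c r e j f lo hi b b' := by
    rintro lo hi b b' h4 h5 ⟨d, hd, hdw, ht, htw, hcl, hclen⟩
    refine ⟨d, hd, ⟨hz'.path.mono h4 h5, hdw, fun m h6 h7 => ?_⟩, ⟨ht, htw⟩, hcl, by omega⟩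
    have := hlen m (by omega) (by omega)
    omega
  refine ⟨e, i', i'', k'', k', he, hii, hii', hik'', hkk', hkk,
    ⟨hz'.path.mono hii' hkk', hew, fun m h4 h5 => ?_⟩, fun hlt => ⟨hpre' hlt, ?_⟩,
    fun hlt => ⟨hsuf' hlt, ?_⟩, fun hlt => hlow _ _ _ _ le_rfl (by omega) (hlo hlt),
    fun hlt => hlow _ _ _ _ (by omega) le_rfl (hhi hlt)⟩
  · have := hlen' m h4 h5
    omega
  -- The vertex at `i'` is the parent of a deepest node, hence in the second layer, so the first
  -- layer is reached only later.
  · have e1 := (hpre' hlt).2.2.2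
    rcases lt_or_eq_of_le hii' with hh | hh
    · exact hh
    · have := hlen' i'' le_rfl hik''
      rw [← hh] at this
      omega
  · have e1 := (hsuf' hlt).2.2.2
    rcases lt_or_eq_of_le hkk' with hh | hh
    · exact hh
    · have := hlen' k'' hik'' le_rfl
      rw [hh] at this
      omega

theorem ZonePath.leaf_top_le (hj : 1 ≤ j) (hl : LevelAt l r.length j)
    (hz : ZonePath c r j f i k) (hik : i ≤ k) (hleaf : AtLeaf r j (f i)) (htop : AtTop r (f k)) :
    k - i ≤ 6 := by
  have := hz.reverse.top_leaf_le hj hl (by simpa using htop) (by simpa using hleaf)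
  omega

/-- A bound for the paths between leaves. -/
def LeafBound (c : Choices (h l)) (j : ℕ) (E : ℤ) : Prop :=
  ∀ (d : List Bool) (f : ℤ → Vertex (h l)) (i k : ℤ), LevelAt l d.length j → ZonePath c d j f i k →
    i ≤ k → AtLeaf d j (f i) → AtLeaf d j (f k) → k - i ≤ E

/-- A bound for the paths that start at a leaf or at a top-predecessor of the root. -/
def StartBound (c : Choices (h l)) (j : ℕ) (M : ℤ) : Prop :=
  ∀ (d : List Bool) (f : ℤ → Vertex (h l)) (i k : ℤ), LevelAt l d.length j → ZonePath c d j f i k →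
    i ≤ k → AtLeaf d j (f i) ∨ AtTop d (f i) → k - i ≤ M

/-- A bound for all paths. -/
def FullBound (c : Choices (h l)) (j : ℕ) (F : ℤ) : Prop :=
  ∀ (d : List Bool) (f : ℤ → Vertex (h l)) (i k : ℤ), LevelAt l d.length j → ZonePath c d j f i k →
    i ≤ k → k - i ≤ F

theorem StartBound.reverse {M : ℤ} (hM : StartBound c j M) {d : List Bool}
    (hl : LevelAt l d.length j) (hz : ZonePath c d j f i k) (hik : i ≤ k)
    (hend : AtLeaf d j (f k) ∨ AtTop d (f k)) : k - i ≤ M := by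
  have := hM d _ _ _ hl hz.reverse (by omega) (by simpa using hend)
  omega

/-- Paths that avoid the root and start at a top-predecessor of a child of the root or in a deepest
node. -/
theorem ZonePath.avoid_le {E M : ℤ} (hj : 1 ≤ j) (hl : LevelAt l r.length (j + 1))
    (hE0 : 0 ≤ E) (hM0 : 0 ≤ M) (hE : LeafBound c j E) (hM : StartBound c j M)
    (hz : ZonePath c r (j + 1) f i k) (hik : i ≤ k)
    (hr : ∀ m, i ≤ m → m ≤ k → (f m).word ≠ r)
    (hstart : ((f i).IsTop ∧ (f i).word.length = r.length + 1) ∨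
      (f i).word.length + 1 = r.length + h (j + 1)) : k - i ≤ M + E + 40 := by
  have hs := h_succ hj
  have h3 := three_le_h hj
  have hl1 : ∀ e : List Bool, e.length = r.length + 1 → LevelAt l e.length j := by
    intro e he
    rw [he]
    exact hl.first hj
  have hl2 : ∀ d : List Bool, d.length = r.length + 1 + h j → LevelAt l d.length j := by
    intro d hd
    rw [hd]
    exact hl.second hj
  rcases hz.decomp hj hl hik hr with hA | ⟨d, i', k', hd, h4, h5, h6, hzd, hpre, hsuf⟩ |
    ⟨e, i', i'', k'', k', he, h4, h5, h6, h7, h8, hze, hpre, hsuf, hlo, hhi⟩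
  · omega
  · have hk' : k - k' ≤ 7 := by
      rcases lt_or_eq_of_le h6 with hh | hh
      · have := (hsuf hh).2.1
        omega
      · omega
    rcases lt_or_eq_of_le h4 with hh | hh
    · have hp := hpre hh
      have := hp.2.1
      have := hM d f i' k' (hl2 d hd) hzd h5 (Or.inl ⟨hp.2.2.1, by rw [hp.2.2.2]; omega⟩)
      omega
    -- A start in the second layer contradicts `hstart`.
    · subst hh
      have e1 := hzd.le_length le_rfl h5
      have e2 := hzd.length_lt i le_rfl h5
      omega
  · have hk' : k - k' ≤ 7 := by
      rcases lt_or_eq_of_le h8 with hh | hh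
      · have := (hsuf hh).1.2.1
        omega
      · omega
    have htail : k' - k'' ≤ M + 1 := by
      rcases lt_or_eq_of_le h7 with hh | hh
      · obtain ⟨d, hd, hzd, ht, -⟩ := hhi hh
        have := hM d f _ _ (hl2 d hd) hzd (by omega) (Or.inr ht)
        omega
      · omega
    -- Leaving the first-layer sublevel downwards means leaving it from a leaf. This costs `E` after
    -- a start at a leaf and a constant after a start at its top; the descent in the second layer
    -- then costs at most `M`.
    have hmid : AtLeaf e j (f i'') ∨ AtTop e (f i'') → k' - i'' ≤ M + E + 8 := by
      intro hst
      rcases lt_or_eq_of_le h7 with hh | hh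
      · obtain ⟨d, hd, hzd, ht, hlf⟩ := hhi hh
        rcases hst with hst | hst
        · have := hE e f _ _ (hl1 e he) hze h6 hst hlf
          omega
        · have := hze.top_leaf_le hj (hl1 e he) hst hlf
          omega
      · have := hM e f _ _ (hl1 e he) hze h6 hst
        omega
    rcases lt_or_eq_of_le h4 with hh | hh
    · obtain ⟨hp, h9⟩ := hpre hh
      have := hp.2.1
      obtain ⟨d, hd, hzd, ht, hlf⟩ := hlo h9
      have := hzd.leaf_top_le hj (hl2 d hd) (by omega) ⟨hp.2.2.1, by rw [hp.2.2.2]; omega⟩ ht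
      have := hmid (Or.inl hlf)
      omega
    · subst hh
      rcases lt_or_eq_of_le h5 with hh | hh
      · obtain ⟨d, hd, hzd, -⟩ := hlo hh
        have e1 := hzd.le_length le_rfl (by omega)
        have e2 := hzd.length_lt i le_rfl (by omega)
        omega
      · subst hh
        have e1 := hze.length_lt i le_rfl h6
        rcases hstart with ⟨hst, hst'⟩ | hst
        · have := hmid (Or.inr ⟨hst, ((hze.suffix i le_rfl h6).eq_of_length (by omega)).symm⟩)
          omega
        · omega

/-- Paths that start in the root. -/
theorem ZonePath.root_start_le {E M : ℤ} (hj : 1 ≤ j) (hl : LevelAt l r.length (j + 1))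
    (hE0 : 0 ≤ E) (hM0 : 0 ≤ M) (hE : LeafBound c j E) (hM : StartBound c j M)
    (hz : ZonePath c r (j + 1) f i k) (hik : i ≤ k) (hr : (f i).word = r) :
    k - i ≤ M + E + 47 := by
  obtain ⟨q, hq1, hq2, hq3, hq4⟩ := exists_last (Q := fun n => (f n).word = r) hik hr
  have hqi := hz.root_le le_rfl hq2 hr hq3
  rcases lt_or_eq_of_le hq2 with hh | hh
  · have hlt := hz.length_lt (q + 1) (by omega) (by omega)
    have hge := hz.lt_length (m := q + 1) (by omega) (by omega) (hq4 _ (by omega) (by omega))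
    have := (hz.mono (i' := q + 1) (k' := k) (by omega) le_rfl).avoid_le hj hl hE0 hM0 hE hM
      (by omega) (fun m h1 h2 => hq4 m (by omega) h2) (by
        rcases hz.leave (a := q) (b := q + 1) (by omega) (by omega)
          (hz.path.adj_succ (by omega) (by omega) rfl) hq3 (hq4 _ (by omega) (by omega)) with e | e
        · exact Or.inl ⟨e.2.1, by rw [e.length, hq3]⟩
        -- A rib from the root inside the level comes from the outer interval and so leads to a
        -- deepest node.
        · right
          have hN := e.2.2.2.2
          rw [hq3] at hN
          exact (hl.ends (by omega) (by omega) (by omega) hN).1 rfl)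
    omega
  · omega

/-- Paths from the root to a leaf. -/
theorem ZonePath.root_leaf_le (hj : 1 ≤ j) (hl : LevelAt l r.length j)
    (hz : ZonePath c r j f i k) (hik : i ≤ k) (hr : (f i).word = r) (hleaf : AtLeaf r j (f k)) :
    k - i ≤ 48 := by
  -- Level `1` has no sublevels; its vertex count supplies the bound `48`.
  rcases lt_or_eq_of_le hj with hj1 | hj1
  swap
  · subst hj1
    exact hz.base_le
  obtain ⟨j, rfl⟩ := Nat.exists_eq_add_of_le' hj
  have hj' : 1 ≤ j := by omega
  have hs := h_succ hj'
  have h3 := three_le_h hj'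
  by_cases hex : ∃ m, i ≤ m ∧ m ≤ k ∧ (f m).OnTopEdge c ∧ (f m).word = r
  · obtain ⟨m, h1, h2, h4, h5⟩ := hex
    have := hz.root_le le_rfl h2 hr h5
    have := hz.topEdge_leaf_le hj hl h1 h2 le_rfl h4 h5 hleaf
    omega
  have hl1 : ∀ e : List Bool, e.length = r.length + 1 → LevelAt l e.length j := by
    intro e he
    rw [he]
    exact hl.first hj'
  have hl2 : ∀ d : List Bool, d.length = r.length + 1 + h j → LevelAt l d.length j := by
    intro d hd
    rw [hd]
    exact hl.second hj'
  obtain ⟨q, hq1, hq2, hq3, hq4⟩ := exists_last (Q := fun n => (f n).word = r) hik hr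
  have hqi := hz.root_le le_rfl hq2 hr hq3
  have hqk : q ≠ k := by
    rintro rfl
    have := hleaf.2
    rw [hq3] at this
    omega
  -- A path that never uses the top edge of the root cannot leave the root by a rib, so it goes to
  -- the top of a child.
  have htop : (f (q + 1)).IsTop ∧ (f (q + 1)).word.length = r.length + 1 := by
    rcases hz.leave (a := q) (b := q + 1) (by omega) (by omega)
      (hz.path.adj_succ (by omega) (by omega) rfl) hq3 (hq4 _ (by omega) (by omega)) with e | e
    · exact ⟨e.2.1, by rw [e.length, hq3]⟩
    · exact absurd ⟨q, by omega, by omega, e.1, hq3⟩ hex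
  have hlf := hleaf.2
  rcases (hz.mono (i' := q + 1) (k' := k) (by omega) le_rfl).decomp hj' hl (by omega)
      (fun m h1 h2 => hq4 m (by omega) h2) with hA | ⟨d, i', k', hd, h4, h5, h6, hzd, hpre, hsuf⟩ |
    ⟨e, i', i'', k'', k', he, h4, h5, h6, h7, h8, hze, hpre, hsuf, hlo, hhi⟩
  · omega
  -- The path starts at the first depth below the root and ends in a deepest node. So it must pass
  -- from top to leaf through one sublevel of each layer, and every other shape is contradictory.
  · rcases lt_or_eq_of_le h4 with hh | hh
    · have := (hpre hh).1 (q + 1) le_rfl (by omega)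
      omega
    · subst hh
      have := hzd.le_length le_rfl h5
      omega
  · rcases lt_or_eq_of_le h4 with hh | hh
    · have := (hpre hh).1.1 (q + 1) le_rfl (by omega)
      omega
    subst hh
    rcases lt_or_eq_of_le h5 with hh | hh
    · obtain ⟨d, hd, hzd, -⟩ := hlo hh
      have := hzd.le_length (m := q + 1) le_rfl (by omega)
      omega
    subst hh
    rcases lt_or_eq_of_le h8 with hh | hh
    · obtain ⟨hp, h9⟩ := hsuf hh
      have := hp.2.1
      obtain ⟨d, hd, hzd, ht, hlf'⟩ := hhi h9
      have := hzd.top_leaf_le hj' (hl2 d hd) ht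
        ⟨hp.2.2.1, by rw [hp.2.2.2]; omega⟩
      have := hze.top_leaf_le hj' (hl1 e he) ⟨htop.1,
        ((hze.suffix _ le_rfl h6).eq_of_length (by omega)).symm⟩ hlf'
      omega
    · subst hh
      rcases lt_or_eq_of_le h7 with hh | hh
      · obtain ⟨d, hd, hzd, -⟩ := hhi hh
        have := hzd.length_lt k' (by omega) le_rfl
        omega
      · subst hh
        have := hze.length_lt k'' (by omega) le_rfl
        omega

theorem ZonePath.leaf_root_le (hj : 1 ≤ j) (hl : LevelAt l r.length j)
    (hz : ZonePath c r j f i k) (hik : i ≤ k) (hleaf : AtLeaf r j (f i)) (hr : (f k).word = r) :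
    k - i ≤ 48 := by
  have := hz.reverse.root_leaf_le hj hl (by omega) (by simpa using hr) (by simpa using hleaf)
  omega

/-! ### The bounds -/

/-- A path through the root is two root-to-leaf passages. Otherwise both ends lie in deepest nodes,
and only the highest visited sublevel is traversed from leaf to leaf; all other pieces are bounded.
Thus the bound grows by a constant with `j`. -/
theorem leafBound (c : Choices (h l)) (hj : 1 ≤ j) : LeafBound c j (100 * j) := by
  induction j, hj using Nat.le_induction with
  | base =>
    intro d f i k _ hz _ _ _
    have := hz.base_le
    omega
  | succ j hj ih =>
    intro r f i k hl hz hik hi hk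
    have hs := h_succ hj
    have h3 := three_le_h hj
    have hi2 := hi.2
    have hk2 := hk.2
    push_cast
    by_cases hex : ∃ m, i ≤ m ∧ m ≤ k ∧ (f m).word = r
    · obtain ⟨m, h1, h2, hm⟩ := hex
      have := (hz.mono (i' := i) (k' := m) le_rfl h2).leaf_root_le (by omega) hl h1 hi hm
      have := (hz.mono (i' := m) (k' := k) h1 le_rfl).root_leaf_le (by omega) hl h2 hm hk
      omega
    push Not at hex
    have hl1 : ∀ e : List Bool, e.length = r.length + 1 → LevelAt l e.length j := by
      intro e he
      rw [he]
      exact hl.first hj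
    have hl2 : ∀ d : List Bool, d.length = r.length + 1 + h j → LevelAt l d.length j := by
      intro d hd
      rw [hd]
      exact hl.second hj
    rcases hz.decomp hj hl hik hex with hA | ⟨d, i', k', hd, h4, h5, h6, hzd, hpre, hsuf⟩ |
      ⟨e, i', i'', k'', k', he, h4, h5, h6, h7, h8, hze, hpre, hsuf, hlo, hhi⟩
    · omega
    · have hi' : i < i' := by
        rcases lt_or_eq_of_le h4 with hh | hh
        · exact hh
        · subst hh
          have := hzd.length_lt i le_rfl h5
          omega
      have hk' : k' < k := by
        rcases lt_or_eq_of_le h6 with hh | hh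
        · exact hh
        · subst hh
          have := hzd.length_lt k' h5 le_rfl
          omega
      have p := hpre hi'
      have s := hsuf hk'
      have := p.2.1
      have := s.2.1
      have := ih d f i' k' (hl2 d hd) hzd h5 ⟨p.2.2.1, by rw [p.2.2.2]; omega⟩
        ⟨s.2.2.1, by rw [s.2.2.2]; omega⟩
      omega
    · have hi' : i < i' := by
        rcases lt_or_eq_of_le h4 with hh | hh
        · exact hh
        · subst hh
          rcases lt_or_eq_of_le h5 with hh | hh
          · obtain ⟨d, hd, hzd, -⟩ := hlo hh
            have := hzd.length_lt i le_rfl (by omega)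
            omega
          · subst hh
            have := hze.length_lt i le_rfl h6
            omega
      have hk' : k' < k := by
        rcases lt_or_eq_of_le h8 with hh | hh
        · exact hh
        · subst hh
          rcases lt_or_eq_of_le h7 with hh | hh
          · obtain ⟨d, hd, hzd, -⟩ := hhi hh
            have := hzd.length_lt k' (by omega) le_rfl
            omega
          · subst hh
            have := hze.length_lt k'' h6 le_rfl
            omega
      obtain ⟨p, hi''⟩ := hpre hi'
      obtain ⟨s, hk''⟩ := hsuf hk'
      have := p.2.1
      have := s.2.1
      obtain ⟨d, hd, hzd, ht, hlf⟩ := hlo hi''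
      obtain ⟨d', hd', hzd', ht', hlf'⟩ := hhi hk''
      have := hzd.leaf_top_le hj (hl2 d hd) (by omega) ⟨p.2.2.1, by rw [p.2.2.2]; omega⟩ ht
      have := hzd'.top_leaf_le hj (hl2 d' hd') ht' ⟨s.2.2.1, by rw [s.2.2.2]; omega⟩
      have := ih e f _ _ (hl1 e he) hze h6 hlf hlf'
      omega

/-- The recursion is `M (j + 1) ≤ M j + E j + const` with the linear leaf bound `E`: the part of the
path in its last sublevel costs `M j`, and at most one leaf-to-leaf passage precedes it. -/
theorem startBound (c : Choices (h l)) (hj : 1 ≤ j) : StartBound c j (100 * j ^ 2) := by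
  induction j, hj using Nat.le_induction with
  | base =>
    intro d f i k _ hz _ _
    have := hz.base_le
    norm_num
    omega
  | succ j hj ih =>
    intro r f i k hl hz hik hst
    have hE := leafBound c hj
    have hM0 : (0 : ℤ) ≤ 100 * j ^ 2 := by positivity
    -- Expanding the square lets `100 * j ^ 2` be treated as an atom `M`, after which the recursion
    -- is linear arithmetic.
    have hgoal : (100 : ℤ) * ((j + 1 : ℕ) : ℤ) ^ 2 = 100 * j ^ 2 + 100 * j + 100 * j + 100 := by
      push_cast
      ring
    rw [hgoal]
    generalize (100 : ℤ) * j ^ 2 = M at *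
    rcases hst with hst | hst
    · by_cases hex : ∃ m, i ≤ m ∧ m ≤ k ∧ (f m).word = r
      · obtain ⟨m, h1, h2, hm⟩ := hex
        have := (hz.mono (i' := i) (k' := m) le_rfl h2).leaf_root_le (by omega) hl h1 hst hm
        have := (hz.mono (i' := m) (k' := k) h1 le_rfl).root_start_le hj hl (by positivity) hM0 hE
          ih h2 hm
        omega
      · push Not at hex
        have := hz.avoid_le hj hl (by positivity) hM0 hE ih hik hex (Or.inr hst.2)
        omega
    · have := hz.root_start_le hj hl (by positivity) hM0 hE ih hik hst.2
      omega

/-- A path through the root splits into two paths starting there. Otherwise either the whole path is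
one sublevel path up to bounded ends, or it has two parts with a controlled end and at most one
leaf-to-leaf part, which gives `2 M + E + const`. -/
theorem fullBound (c : Choices (h l)) (hj : 1 ≤ j) : FullBound c j (200 * j ^ 2) := by
  induction j, hj using Nat.le_induction with
  | base =>
    intro d f i k _ hz _
    have := hz.base_le
    norm_num
    omega
  | succ j hj ih =>
    intro r f i k hl hz hik
    have hE := leafBound c hj
    have hM := startBound c hj
    have hM0 : (0 : ℤ) ≤ 100 * j ^ 2 := by positivity
    have hgoal : (200 : ℤ) * ((j + 1 : ℕ) : ℤ) ^ 2 =
        2 * (100 * j ^ 2) + 2 * (100 * j) + 2 * (100 * j) + 200 := by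
      push_cast
      ring
    rw [hgoal]
    rw [show (200 : ℤ) * j ^ 2 = 2 * (100 * j ^ 2) by ring] at ih
    generalize (100 : ℤ) * j ^ 2 = M at *
    have hE0 : (0 : ℤ) ≤ 100 * j := by positivity
    by_cases hex : ∃ m, i ≤ m ∧ m ≤ k ∧ (f m).word = r
    · obtain ⟨m, h1, h2, hm⟩ := hex
      have := (hz.mono (i' := m) (k' := k) h1 le_rfl).root_start_le hj hl hE0 hM0 hE hM h2 hm
      have := (hz.mono (i' := i) (k' := m) le_rfl h2).reverse.root_start_le hj hl hE0 hM0 hE hM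
        (by omega) (by simpa using hm)
      omega
    push Not at hex
    have hl1 : ∀ e : List Bool, e.length = r.length + 1 → LevelAt l e.length j := by
      intro e he
      rw [he]
      exact hl.first hj
    have hl2 : ∀ d : List Bool, d.length = r.length + 1 + h j → LevelAt l d.length j := by
      intro d hd
      rw [hd]
      exact hl.second hj
    rcases hz.decomp hj hl hik hex with hA | ⟨d, i', k', hd, h4, h5, h6, hzd, hpre, hsuf⟩ |
      ⟨e, i', i'', k'', k', he, h4, h5, h6, h7, h8, hze, hpre, hsuf, hlo, hhi⟩
    · omega
    · have hi' : i' - i ≤ 7 := by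
        rcases lt_or_eq_of_le h4 with hh | hh
        · have := (hpre hh).2.1
          omega
        · omega
      have hk' : k - k' ≤ 7 := by
        rcases lt_or_eq_of_le h6 with hh | hh
        · have := (hsuf hh).2.1
          omega
        · omega
      have := ih d f i' k' (hl2 d hd) hzd h5
      omega
    · have hi' : i' - i ≤ 7 := by
        rcases lt_or_eq_of_le h4 with hh | hh
        · have := (hpre hh).1.2.1
          omega
        · omega
      have hk' : k - k' ≤ 7 := by
        rcases lt_or_eq_of_le h8 with hh | hh
        · have := (hsuf hh).1.2.1
          omega
        · omega
      rcases lt_or_eq_of_le h5 with hh | hh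
      · obtain ⟨d, hd, hzd, ht, hlf⟩ := hlo hh
        have := hM.reverse (hl2 d hd) hzd (by omega) (Or.inr ht)
        rcases lt_or_eq_of_le h7 with hh' | hh'
        · obtain ⟨d', hd', hzd', ht', hlf'⟩ := hhi hh'
          have := hM d' f _ _ (hl2 d' hd') hzd' (by omega) (Or.inr ht')
          have := hE e f _ _ (hl1 e he) hze h6 hlf hlf'
          omega
        · have := hM e f _ _ (hl1 e he) hze h6 (Or.inl hlf)
          omega
      · rcases lt_or_eq_of_le h7 with hh' | hh'
        · obtain ⟨d', hd', hzd', ht', hlf'⟩ := hhi hh'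
          have := hM d' f _ _ (hl2 d' hd') hzd' (by omega) (Or.inr ht')
          have := hM.reverse (hl1 e he) hze h6 (Or.inl hlf')
          omega
        · have := ih e f _ _ (hl1 e he) hze h6
          omega

/-- Induced paths of the graph `G_ℓ` have at most `200 ℓ ^ 2 + 1` vertices. -/
theorem IndPath.order_le (hl : 1 ≤ l) (hf : IndPath (ribbedGraph l c) f i k) (hik : i ≤ k) :
    k - i ≤ 200 * l ^ 2 :=
  fullBound c hl [] f i k levelAt_zero
    ⟨hf, fun _ _ _ => List.nil_suffix, fun m _ _ => by
      have : (f m).word.length < h l := by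
        rcases f m with ⟨s, i⟩ | ⟨t, ht, side⟩ | ⟨t, ht, side⟩
        · exact s.2
        · exact t.2
        · exact t.2
      simpa using this⟩ hik

end Decomposition

/-! ### Degeneracy -/

theorem Vertex.word_length_lt {p : ℕ} (v : Vertex p) : v.word.length < p := by
  rcases v with ⟨s, i⟩ | ⟨t, ht, side⟩ | ⟨t, ht, side⟩
  · exact s.2
  · exact t.2
  · exact t.2

theorem finite_vertex (p : ℕ) : Finite (Vertex p) := by
  have : Finite (Node p) := (List.finite_length_lt Bool p).to_subtype
  refine Finite.of_injective
    (fun v : Vertex p => ((⟨v.word, v.word_length_lt⟩ : Node p), v.code)) fun u v huv => ?_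
  obtain ⟨h1, h2⟩ := Prod.mk.inj huv
  exact Vertex.ext_code (congrArg Subtype.val h1) h2

open Classical in
/-- The vertices in the order of the construction: by depth, and in a node first the predecessors,
then the top edge, then the third vertex of the triangle. -/
noncomputable def Vertex.rank {p : ℕ} (c : Choices p) : Vertex p → ℕ
  | .clique s i => 4 * s.1.length + if (Vertex.clique s i).OnTopEdge c then 2 else 3
  | .top t _ _ => 4 * t.1.length
  | .bot t _ _ => 4 * t.1.length + 1

theorem Vertex.le_rank {p : ℕ} (c : Choices p) (v : Vertex p) : 4 * v.word.length ≤ v.rank c := by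
  cases v <;> simp [Vertex.rank, Vertex.word]

theorem two_le_rank_clique {p : ℕ} (c : Choices p) (s : Node p) (i : Fin 3) :
    4 * s.1.length + 2 ≤ (Vertex.clique s i).rank c := by
  simp only [Vertex.rank]
  split <;> omega

/-- Every vertex has at most two neighbours that are not of higher rank. -/
theorem exists_pair_of_adj {l : ℕ} (hl : 1 ≤ l) (c : Choices (h l)) (v : Vertex (h l)) :
    ∃ a b, ∀ u, (ribbedGraph l c).Adj v u → u.rank c ≤ v.rank c → u = a ∨ u = b := by
  -- At most one ancestor sends ribs to `t`; if there is none, `t` itself is a dummy value.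
  have hrib : ∀ t : Node (h l), ∃ s₀ : Node (h l), ∀ s : Node (h l), s.1 <:+ t.1 →
      (s.depth, t.depth) ∈ nested l → s = s₀ := by
    intro t
    by_cases hex : ∃ s₀ : Node (h l), s₀.1 <:+ t.1 ∧ (s₀.depth, t.depth) ∈ nested l
    · obtain ⟨s₀, h1, h2⟩ := hex
      refine ⟨s₀, fun s h3 h4 => Subtype.ext (suffix_unique h3 h1 ?_)⟩
      have := nested_left_unique hl _ _ _ h4 h2
      simpa [Node.depth] using this
    · exact ⟨t, fun s h3 h4 => absurd ⟨s, h3, h4⟩ hex⟩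
  rcases v with ⟨s, i⟩ | ⟨t, ht, side⟩ | ⟨t, ht, side⟩
  · by_cases htop : (Vertex.clique s i).OnTopEdge c
    · have hr : (Vertex.clique s i).rank c = 4 * s.1.length + 2 := by simp [Vertex.rank, htop]
      obtain ⟨s', sd, hs⟩ := htop
      injection hs with hs1 hs2
      subst hs1 hs2
      have hclique : ∀ j, c.att s none sd ≠ j →
          (Vertex.clique s j).rank c ≤ 4 * s.1.length + 2 → j = c.att s none (!sd) := by
        intro j hij hj
        have : (Vertex.clique s j).OnTopEdge c := by
          by_contra hno
          simp [Vertex.rank, hno] at hj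
        obtain ⟨s', sd', hs⟩ := this
        injection hs with hs1 hs2
        subst hs1 hs2
        have : sd' ≠ sd := by
          rintro rfl
          exact hij rfl
        rw [show sd' = !sd by cases sd <;> cases sd' <;> simp_all]
      have hside : ∀ sd', c.att s none sd' = c.att s none sd → sd' = sd := by
        intro sd' he
        have := c.att_ne s none
        cases sd <;> cases sd' <;> simp_all
      -- The root has no predecessors, so its second candidate is a dummy.
      obtain ⟨y, hy⟩ : ∃ y, ∀ ht : s.1 ≠ [], Vertex.bot s ht sd = y := by
        by_cases hroot : s.1 = []
        · exact ⟨.clique s 0, fun ht => absurd hroot ht⟩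
        · exact ⟨.bot s hroot sd, fun _ => rfl⟩
      refine ⟨.clique s (c.att s none (!sd)), y, fun u huv hu => ?_⟩
      rw [hr] at hu
      generalize hi : c.att s none sd = i at huv
      rcases huv.2 with (e | ⟨s1, t1, h1, h2, -, e⟩) | (e | ⟨s1, t1, h1, h2, -, e⟩)
      · cases e with
        | triangle _ _ j hij => exact Or.inl (by rw [hclique j (by rwa [hi]) hu])
        | ux _ t ht b hst side =>
          simp [Vertex.rank, hst] at hu
          omega
      · have := rib_lt h1 h2 e
        have := u.le_rank c
        simp only [Vertex.word] at *
        omega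
      · cases e with
        | triangle _ j _ hij => exact Or.inl (by rw [hclique j (by rw [hi]; exact hij.symm) hu])
        | yv t ht side =>
          right
          rw [← hy ht, hside side hi.symm]
      · cases e
    · have hr : (Vertex.clique s i).rank c = 4 * s.1.length + 3 := by simp [Vertex.rank, htop]
      refine ⟨.clique s (i + 1), .clique s (i + 2), fun u huv hu => ?_⟩
      rw [hr] at hu
      have h3 : ∀ i j : Fin 3, i ≠ j → j = i + 1 ∨ j = i + 2 := by decide
      rcases huv.2 with (e | ⟨s1, t1, h1, h2, -, e⟩) | (e | ⟨s1, t1, h1, h2, -, e⟩)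
      · cases e with
        | triangle _ _ j hij => rcases h3 i j hij with h | h <;> simp [h]
        | ux _ t ht b hst side =>
          simp [Vertex.rank, hst] at hu
          omega
      · have := rib_lt h1 h2 e
        have := u.le_rank c
        simp only [Vertex.word] at *
        omega
      · cases e with
        | triangle _ j _ hij => rcases h3 i j hij.symm with h | h <;> simp [h]
        | yv t ht side => exact absurd ⟨_, _, rfl⟩ htop
      · cases e
  · obtain ⟨s₀, hs₀⟩ := hrib t
    obtain ⟨b, w, hbw⟩ := List.exists_cons_of_ne_nil ht
    have hw : w.length < h l := by
      have := t.2
      rw [hbw] at this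
      simp only [List.length_cons] at this
      omega
    refine ⟨.clique ⟨w, hw⟩ (c.att ⟨w, hw⟩ (some b) side),
      .clique s₀ (c.att s₀ none (c.orient s₀ t)), fun u huv hu => ?_⟩
    rcases huv.2 with (e | ⟨s1, t1, h1, h2, -, e⟩) | (e | ⟨s1, t1, h1, h2, h4, e⟩)
    · cases e
      simp [Vertex.rank] at hu
    · cases e
    · cases e with
      | ux s _ _ b' hst _ =>
        left
        rw [hbw] at hst
        obtain ⟨rfl, hs⟩ := List.cons.inj hst
        obtain rfl : s = ⟨w, hw⟩ := Subtype.ext hs.symm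
        rfl
    · cases e
      rw [hs₀ s1 h1 h4]
      exact Or.inr rfl
  · obtain ⟨s₀, hs₀⟩ := hrib t
    refine ⟨.top t ht side, .clique s₀ (c.att s₀ none (!c.orient s₀ t)), fun u huv hu => ?_⟩
    rcases huv.2 with (e | ⟨s1, t1, h1, h2, -, e⟩) | (e | ⟨s1, t1, h1, h2, h4, e⟩)
    · cases e
      have := two_le_rank_clique c t (c.att t none side)
      simp only [Vertex.rank] at *
      omega
    · cases e
    · cases e
      exact Or.inl rfl
    · cases e
      rw [hs₀ s1 h1 h4]
      exact Or.inr rfl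

/-- In a vertex of maximal rank of the subgraph, all neighbours are of rank at most its own. Ties,
such as the two ends of a top edge, are harmless. -/
theorem isDegenerate_ribbedGraph {l : ℕ} (hl : 1 ≤ l) (c : Choices (h l)) :
    IsDegenerate (ribbedGraph l c) 2 := by
  intro H hH
  have := finite_vertex (h l)
  obtain ⟨v, hv, hmax⟩ := Set.exists_max_image H.verts (Vertex.rank c) (Set.toFinite _) hH
  obtain ⟨a, b, hab⟩ := exists_pair_of_adj hl c v
  refine ⟨v, hv, ?_⟩
  have hsub : H.neighborSet v ⊆ {a, b} := fun u hu =>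
    hab u (H.adj_sub hu) (hmax u (H.edge_vert hu.symm))
  exact (Set.encard_le_encard hsub).trans ((Set.encard_insert_le _ _).trans (by
    rw [Set.encard_singleton]
    norm_num))

theorem IsDegenerate.mono {V : Type*} {G : SimpleGraph V} {k k' : ℕ} (hG : IsDegenerate G k)
    (hk : k ≤ k') : IsDegenerate G k' := by
  intro H hH
  obtain ⟨v, hv, hd⟩ := hG H hH
  exact ⟨v, hv, hd.trans (by exact_mod_cast hk)⟩

/-! ### The number of vertices -/

theorem two_pow_le_h {l : ℕ} (hl : 1 ≤ l) : 2 ^ (l + 1) ≤ h l + 1 := by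
  induction l, hl using Nat.le_induction with
  | base => simp [h]
  | succ l hl ih =>
    rw [h_succ hl, pow_succ]
    omega

/-- The four predecessors of each of the `2 ^ (p - 1)` leaves already suffice; `2 ≤ p` ensures that
a leaf is not the root. -/
theorem two_pow_le_card {p : ℕ} (hp : 2 ≤ p) : 2 ^ (p + 1) ≤ Nat.card (Vertex p) := by
  have := finite_vertex p
  have hlt : ∀ w : List.Vector Bool (p - 1), w.1.length < p := fun w => by
    have := w.2
    omega
  have hne : ∀ w : List.Vector Bool (p - 1), w.1 ≠ [] := fun w hw => by
    have := w.2
    rw [hw] at this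
    simp only [List.length_nil] at this
    omega
  let g : List.Vector Bool (p - 1) × Bool × Bool → Vertex p := fun x =>
    bif x.2.1 then .top ⟨x.1.1, hlt x.1⟩ (hne x.1) x.2.2 else .bot ⟨x.1.1, hlt x.1⟩ (hne x.1) x.2.2
  have hg : Function.Injective g := by
    rintro ⟨x, a, b⟩ ⟨x', a', b'⟩ hx
    cases a <;> cases a' <;> simp [g] at hx
    · simp [Subtype.ext hx.1, hx.2]
    · simp [Subtype.ext hx.1, hx.2]
  have hcard := Nat.card_le_card_of_injective g hg
  rw [Nat.card_prod, Nat.card_eq_fintype_card, card_vector] at hcard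
  simp only [Fintype.card_bool, Nat.card_eq_fintype_card, Fintype.card_prod] at hcard
  obtain ⟨q, rfl⟩ : ∃ q, p = q + 1 := ⟨p - 1, by omega⟩
  refine le_trans (le_of_eq ?_) hcard
  simp only [Nat.add_sub_cancel]
  ring

theorem two_pow_two_pow_le_card {l : ℕ} (hl : 1 ≤ l) :
    2 ^ 2 ^ (l + 1) ≤ Nat.card (Vertex (h l)) := by
  have := three_le_h hl
  exact (Nat.pow_le_pow_right (by norm_num) (two_pow_le_h hl)).trans (two_pow_le_card (by omega))

/-! ### Hamiltonian paths -/

section Hamiltonian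

variable {l : ℕ} {c : Choices (h l)}

theorem exists_third : ∀ x y : Fin 3, x ≠ y → ∃ w, w ≠ x ∧ w ≠ y ∧
    ∀ i, i = x ∨ i = w ∨ i = y := by
  decide

/-- The two edges of `K^s` assigned to the children of `s` form a path between the endpoints of
the top edge. -/
theorem exists_ports {p : ℕ} (c : Choices p) (s : Node p) (side : Bool) :
    ∃ w, w ≠ c.att s none side ∧ w ≠ c.att s none (!side) ∧
      (∀ i, i = c.att s none side ∨ i = w ∨ i = c.att s none (!side)) ∧
      ∃ b σ₁ σ₂, c.att s (some b) σ₁ = c.att s none side ∧ c.att s (some b) (!σ₁) = w ∧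
        c.att s (some (!b)) σ₂ = w ∧ c.att s (some (!b)) (!σ₂) = c.att s none (!side) := by
  have hne : ∀ e σ, c.att s e σ ≠ c.att s e (!σ) := by
    intro e σ
    cases σ
    · exact c.att_ne s e
    · exact (c.att_ne s e).symm
  have hinj : ∀ e e' σ σ', e ≠ e' → c.att s e σ = c.att s e' σ' →
      c.att s e (!σ) ≠ c.att s e' (!σ') := by
    intro e e' σ σ' hee h1 h2
    apply hee
    apply c.att_inj s
    rw [Sym2.eq_iff]
    cases σ <;> cases σ' <;> simp_all
  obtain ⟨w, h1, h2, h3⟩ := exists_third _ _ (hne none side)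
  refine ⟨w, h1, h2, h3, ?_⟩
  -- An edge of the triangle other than the top edge contains `w` and exactly one end of the top
  -- edge.
  have hport : ∀ b, (∃ σ, c.att s (some b) σ = c.att s none side ∧ c.att s (some b) (!σ) = w) ∨
      (∃ σ, c.att s (some b) σ = w ∧ c.att s (some b) (!σ) = c.att s none (!side)) := by
    intro b
    have e1 := hne (some b) false
    have e2 := hinj (some b) none false side (by simp)
    have e3 := hinj (some b) none true side (by simp)
    rcases h3 (c.att s (some b) false) with h4 | h4 | h4 <;>
    rcases h3 (c.att s (some b) true) with h5 | h5 | h5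
    · exact absurd (h4.trans h5.symm) e1
    · exact Or.inl ⟨false, h4, h5⟩
    · exact absurd h5 (e2 h4)
    · exact Or.inl ⟨true, h5, h4⟩
    · exact absurd (h4.trans h5.symm) e1
    · exact Or.inr ⟨false, h4, h5⟩
    · exact absurd h4 (e3 h5)
    · exact Or.inr ⟨true, h5, h4⟩
    · exact absurd (h4.trans h5.symm) e1
  -- The two child edges are distinct, so they use different ends of the top edge.
  have hex : ∀ b, (∃ σ, c.att s (some b) σ = c.att s none side ∧ c.att s (some b) (!σ) = w) →
      (∃ σ, c.att s (some (!b)) σ = w ∧ c.att s (some (!b)) (!σ) = c.att s none (!side)) := by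
    rintro b ⟨σ, h4, h5⟩
    rcases hport (!b) with ⟨σ', h6, h7⟩ | h6
    · exact absurd (h5.trans h7.symm) (hinj _ _ σ σ' (by simp) (h4.trans h6.symm))
    · exact h6
  rcases hport false with h4 | h4
  · obtain ⟨σ₂, h6⟩ := hex _ h4
    obtain ⟨σ₁, h5⟩ := h4
    exact ⟨false, σ₁, σ₂, h5.1, h5.2, h6⟩
  · rcases hport true with h5 | ⟨σ', h6, h7⟩
    · obtain ⟨σ₂, h6⟩ := hex _ h5
      obtain ⟨σ₁, h5⟩ := h5
      exact ⟨true, σ₁, σ₂, h5.1, h5.2, h6⟩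
    · obtain ⟨σ, h4, h5⟩ := h4
      exact absurd (h5.trans h7.symm) (hinj _ _ σ σ' (by simp) (h4.trans h6.symm))

/-- `L` is a path from `x` to `y` whose set of vertices is `S`. -/
structure IsPathOn {V : Type*} (G : SimpleGraph V) (x y : V) (S : Set V) (L : List V) : Prop where
  chain : L.IsChain G.Adj
  nodup : L.Nodup
  head : L.head? = some x
  last : L.getLast? = some y
  mem : ∀ v, v ∈ L ↔ v ∈ S

theorem IsPathOn.singleton {V : Type*} (G : SimpleGraph V) (x : V) : IsPathOn G x x {x} [x] :=
  ⟨by simp, by simp, rfl, rfl, by simp⟩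

theorem IsPathOn.append {V : Type*} {G : SimpleGraph V} {x y x' y' : V} {S T : Set V}
    {L L' : List V} (h1 : IsPathOn G x y S L) (h2 : IsPathOn G x' y' T L') (hadj : G.Adj y x')
    (hST : Disjoint S T) : IsPathOn G x y' (S ∪ T) (L ++ L') := by
  refine ⟨?_, ?_, ?_, ?_, ?_⟩
  · rw [List.isChain_append]
    refine ⟨h1.chain, h2.chain, ?_⟩
    intro a ha b hb
    rw [h1.last] at ha
    rw [h2.head] at hb
    simp only [Option.mem_def, Option.some.injEq] at ha hb
    rw [← ha, ← hb]
    exact hadj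
  · rw [List.nodup_append]
    refine ⟨h1.nodup, h2.nodup, ?_⟩
    rintro a ha b hb rfl
    exact Set.disjoint_left.1 hST ((h1.mem a).1 ha) ((h2.mem a).1 hb)
  · simp [h1.head]
  · simp [h2.last]
  · intro v
    rw [List.mem_append, h1.mem, h2.mem]
    rfl

theorem adj_triangle {s : Node (h l)} {i j : Fin 3} (hij : i ≠ j) :
    (ribbedGraph l c).Adj (.clique s i) (.clique s j) :=
  ⟨by simpa using hij, Or.inl (Or.inl (.triangle s i j hij))⟩

theorem adj_parent {s t : Node (h l)} (ht : t.1 ≠ []) {b : Bool} (hst : t.1 = b :: s.1)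
    (side : Bool) :
    (ribbedGraph l c).Adj (.clique s (c.att s (some b) side)) (.top t ht side) :=
  ⟨by simp, Or.inl (Or.inl (.ux s t ht b hst side))⟩

theorem adj_top_bot {t : Node (h l)} (ht : t.1 ≠ []) (side : Bool) :
    (ribbedGraph l c).Adj (.top t ht side) (.bot t ht side) :=
  ⟨by simp, Or.inl (Or.inl (.xy t ht side))⟩

theorem adj_bot_clique {t : Node (h l)} (ht : t.1 ≠ []) (side : Bool) :
    (ribbedGraph l c).Adj (.bot t ht side) (.clique t (c.att t none side)) :=
  ⟨by simp, Or.inl (Or.inl (.yv t ht side))⟩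

/-- The vertices of the nodes below `w`. -/
def below (p : ℕ) (w : List Bool) : Set (Vertex p) :=
  {v | w <:+ v.word}

/-- The vertices of the nodes below `w` except for the predecessors of `w`. -/
def belowTriangle (p : ℕ) (w : List Bool) : Set (Vertex p) :=
  {v | w <:+ v.word ∧ (v.word = w → v.IsClique)}

theorem suffix_iff_cases {w u : List Bool} (b : Bool) :
    w <:+ u ↔ u = w ∨ (b :: w) <:+ u ∨ ((!b) :: w) <:+ u := by
  constructor
  · rintro ⟨e, rfl⟩
    rcases List.eq_nil_or_concat e with rfl | ⟨e, a, rfl⟩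
    · simp
    · right
      by_cases hab : a = b
      · left
        exact ⟨e, by simp [hab]⟩
      · right
        exact ⟨e, by cases a <;> cases b <;> simp_all⟩
  · rintro (rfl | ⟨e, rfl⟩ | ⟨e, rfl⟩)
    · exact List.suffix_rfl
    · exact ⟨e ++ [b], by simp⟩
    · exact ⟨e ++ [!b], by simp⟩

theorem below_disjoint {p : ℕ} {w w' : List Bool} (hlen : w.length = w'.length) (hne : w ≠ w') :
    Disjoint (below p w) (below p w') :=
  Set.disjoint_left.2 fun _ h1 h2 => hne (suffix_unique h1 h2 hlen)

theorem notMem_below_child {p : ℕ} {s : Node p} {i : Fin 3} {b : Bool} :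
    Vertex.clique s i ∉ below p (b :: s.1) := by
  intro hmem
  have := List.IsSuffix.length_le hmem
  simp [Vertex.word] at this

/-- A traversal of the part of the graph below a node extends to its predecessors. -/
theorem IsPathOn.extend {t : Node (h l)} (ht : t.1 ≠ []) {side : Bool} {L : List (Vertex (h l))}
    (hL : IsPathOn (ribbedGraph l c) (.clique t (c.att t none side))
      (.clique t (c.att t none (!side))) (belowTriangle (h l) t.1) L) :
    ∃ Q, IsPathOn (ribbedGraph l c) (.top t ht side) (.top t ht (!side)) (below (h l) t.1) Q := by
  have hside : side ≠ !side := by cases side <;> simp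
  have h1 := ((((IsPathOn.singleton (ribbedGraph l c) (.top t ht side)).append
    (IsPathOn.singleton _ (.bot t ht side)) (adj_top_bot ht side) (by simp)).append hL
    (adj_bot_clique ht side) (by
      rw [Set.disjoint_left]
      rintro v (rfl | rfl) hv <;> exact absurd (hv.2 rfl) id)).append
    (IsPathOn.singleton _ (.bot t ht (!side))) (adj_bot_clique ht _).symm (by
      rw [Set.disjoint_singleton_right]
      rintro ((hv | hv) | hv)
      · simp at hv
      · simp at hv
      · exact hv.2 rfl)).append
    (IsPathOn.singleton _ (.top t ht (!side))) (adj_top_bot ht _).symm (by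
      rw [Set.disjoint_singleton_right]
      rintro (((hv | hv) | hv) | hv)
      · simp at hv
      · simp at hv
      · exact hv.2 rfl
      · simp at hv)
  refine ⟨_, h1.chain, h1.nodup, h1.head, h1.last, fun v => ?_⟩
  rw [h1.mem]
  constructor
  · rintro ((((rfl | rfl) | hv) | rfl) | rfl)
    · exact List.suffix_rfl
    · exact List.suffix_rfl
    · exact hv.1
    · exact List.suffix_rfl
    · exact List.suffix_rfl
  · intro hv
    by_cases hw : v.word = t.1
    · rcases v with ⟨s, i⟩ | ⟨t', ht', sd⟩ | ⟨t', ht', sd⟩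
      · exact Or.inl (Or.inl (Or.inr ⟨hv, fun _ => trivial⟩))
      · obtain rfl : t' = t := Subtype.ext hw
        by_cases hsd : sd = side
        · subst hsd
          exact Or.inl (Or.inl (Or.inl (Or.inl rfl)))
        · obtain rfl : sd = !side := by cases sd <;> cases side <;> simp_all
          exact Or.inr rfl
      · obtain rfl : t' = t := Subtype.ext hw
        by_cases hsd : sd = side
        · subst hsd
          exact Or.inl (Or.inl (Or.inl (Or.inr rfl)))
        · obtain rfl : sd = !side := by cases sd <;> cases side <;> simp_all
          exact Or.inl (Or.inr rfl)
    · exact Or.inl (Or.inl (Or.inr ⟨hv, fun he => absurd he hw⟩))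

/-- The traversal walks along the two child edges of the triangle, from one end of the top edge over
the third vertex `w` to the other end. Each child edge is replaced by a detour down one of its two
attached paths, through everything below the child, and back up the other. -/
theorem exists_traversal (c : Choices (h l)) (n : ℕ) : ∀ (s : Node (h l)) (side : Bool),
    h l = s.1.length + 1 + n → ∃ L, IsPathOn (ribbedGraph l c) (.clique s (c.att s none side))
      (.clique s (c.att s none (!side))) (belowTriangle (h l) s.1) L := by
  induction n with
  | zero =>
    intro s side hn
    obtain ⟨w, hw1, hw2, hw3, -⟩ := exists_ports c s side
    have hne : c.att s none side ≠ c.att s none (!side) := by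
      have := c.att_ne s none
      cases side
      · exact this
      · exact this.symm
    have h1 := ((IsPathOn.singleton (ribbedGraph l c) (.clique s (c.att s none side))).append
      (IsPathOn.singleton _ (.clique s w)) (adj_triangle hw1.symm) (by simpa using hw1.symm)).append
      (IsPathOn.singleton _ (.clique s (c.att s none (!side)))) (adj_triangle hw2) (by
        rw [Set.disjoint_singleton_right]
        rintro (hv | hv)
        · exact hne (by simpa using hv.symm)
        · exact hw2 (by simpa using hv.symm))
    refine ⟨_, h1.chain, h1.nodup, h1.head, h1.last, fun v => ?_⟩
    rw [h1.mem]
    constructor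
    · rintro ((rfl | rfl) | rfl) <;> exact ⟨List.suffix_rfl, fun _ => trivial⟩
    · rintro ⟨hv, hcl⟩
      have hlen := v.word_length_lt
      have hw := (hv.eq_of_length (le_antisymm hv.length_le (by omega))).symm
      specialize hcl hw
      rcases v with ⟨s', i⟩ | ⟨t', ht', sd⟩ | ⟨t', ht', sd⟩
      · obtain rfl : s' = s := Subtype.ext hw
        rcases hw3 i with rfl | rfl | rfl
        · exact Or.inl (Or.inl rfl)
        · exact Or.inl (Or.inr rfl)
        · exact Or.inr rfl
      · exact absurd hcl id
      · exact absurd hcl id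
  | succ n ih =>
    intro s side hn
    obtain ⟨w, hw1, hw2, hw3, b, σ₁, σ₂, e1, e2, e3, e4⟩ := exists_ports c s side
    have hne : c.att s none side ≠ c.att s none (!side) := by
      have := c.att_ne s none
      cases side
      · exact this
      · exact this.symm
    have hchild : ∀ (b σ : Bool) (x y : Fin 3), c.att s (some b) σ = x →
        c.att s (some b) (!σ) = y → ∃ (u v : Vertex (h l)) (Q : List (Vertex (h l))),
        (ribbedGraph l c).Adj (.clique s x) u ∧ (ribbedGraph l c).Adj v (.clique s y) ∧
        IsPathOn (ribbedGraph l c) u v (below (h l) (b :: s.1)) Q := by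
      rintro b σ x y rfl rfl
      have hlt : (b :: s.1).length < h l := by
        rw [List.length_cons]
        omega
      obtain ⟨L, hL⟩ := ih ⟨b :: s.1, hlt⟩ σ (by
        simp only [List.length_cons]
        omega)
      obtain ⟨Q, hQ⟩ := hL.extend (by simp)
      exact ⟨_, _, Q, adj_parent _ rfl σ, (adj_parent _ rfl _).symm, hQ⟩
    obtain ⟨u₁, v₁, Q₁, f1, f2, f3⟩ := hchild b σ₁ _ _ e1 e2
    obtain ⟨u₂, v₂, Q₂, g1, g2, g3⟩ := hchild (!b) σ₂ _ _ e3 e4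
    have h1 := ((((IsPathOn.singleton (ribbedGraph l c) (.clique s (c.att s none side))).append
      f3 f1 (by
        rw [Set.disjoint_singleton_left]
        exact notMem_below_child)).append
      (IsPathOn.singleton _ (.clique s w)) f2 (by
        rw [Set.disjoint_singleton_right]
        rintro (hv | hv)
        · exact hw1 (by simpa using hv)
        · exact notMem_below_child hv)).append g3 g1 (by
        rw [Set.disjoint_left]
        rintro v ((rfl | hv) | rfl)
        · exact notMem_below_child
        · exact Set.disjoint_left.1 (below_disjoint (by simp) (by simp)) hv
        · exact notMem_below_child)).append
      (IsPathOn.singleton _ (.clique s (c.att s none (!side)))) g2 (by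
        rw [Set.disjoint_singleton_right]
        rintro (((hv | hv) | hv) | hv)
        · exact hne (by simpa using hv.symm)
        · exact notMem_below_child hv
        · exact hw2 (by simpa using hv.symm)
        · exact notMem_below_child hv)
    refine ⟨_, h1.chain, h1.nodup, h1.head, h1.last, fun v => ?_⟩
    rw [h1.mem]
    have hsub : ∀ b, v ∈ below (h l) (b :: s.1) → v ∈ belowTriangle (h l) s.1 := by
      intro b hv
      refine ⟨(List.suffix_cons b s.1).trans hv, fun hw => ?_⟩
      have := List.IsSuffix.length_le hv
      rw [hw, List.length_cons] at this
      omega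
    constructor
    · rintro ((((rfl | hv) | rfl) | hv) | rfl)
      · exact ⟨List.suffix_rfl, fun _ => trivial⟩
      · exact hsub _ hv
      · exact ⟨List.suffix_rfl, fun _ => trivial⟩
      · exact hsub _ hv
      · exact ⟨List.suffix_rfl, fun _ => trivial⟩
    · rintro ⟨hv, hcl⟩
      rcases (suffix_iff_cases b).1 hv with hw | hw | hw
      · specialize hcl hw
        rcases v with ⟨s', i⟩ | ⟨t', ht', sd⟩ | ⟨t', ht', sd⟩
        · obtain rfl : s' = s := Subtype.ext hw
          rcases hw3 i with rfl | rfl | rfl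
          · exact Or.inl (Or.inl (Or.inl (Or.inl rfl)))
          · exact Or.inl (Or.inl (Or.inr rfl))
          · exact Or.inr rfl
        · exact absurd hcl id
        · exact absurd hcl id
      · exact Or.inl (Or.inl (Or.inl (Or.inr hw)))
      · exact Or.inl (Or.inr hw)

theorem hasHamiltonianPath_ribbedGraph (hl : 1 ≤ l) (c : Choices (h l)) :
    HasHamiltonianPath (ribbedGraph l c) := by
  have h3 := three_le_h hl
  obtain ⟨L, hL⟩ := exists_traversal c (h l - 1) ⟨[], by simp; omega⟩ false (by simp; omega)
  have hne : L ≠ [] := by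
    rintro rfl
    simpa using hL.head
  refine ⟨_, _, SimpleGraph.Walk.ofSupport L hne hL.chain, ?_, fun w => ?_⟩
  · rw [SimpleGraph.Walk.isPath_def, SimpleGraph.Walk.support_ofSupport]
    exact hL.nodup
  · rw [SimpleGraph.Walk.support_ofSupport, hL.mem]
    -- The root has no predecessors, so the part below its triangle is the whole graph.
    refine ⟨List.nil_suffix, fun hw => ?_⟩
    rcases w with ⟨s', i⟩ | ⟨t', ht', sd⟩ | ⟨t', ht', sd⟩
    · trivial
    · exact absurd hw ht'
    · exact absurd hw ht'

end Hamiltonian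

theorem HasHamiltonianPath.isContained_pathGraph {V : Type*} [Fintype V] {G : SimpleGraph V}
    (hG : HasHamiltonianPath G) : (SimpleGraph.pathGraph (Fintype.card V)).IsContained G := by
  classical
  obtain ⟨u, v, P, hP, hall⟩ := hG
  have hcard : Fintype.card V = P.length + 1 := by
    rw [← P.length_support, ← List.toFinset_card_of_nodup hP.support_nodup, ← Finset.card_univ]
    congr 1
    ext w
    simp [hall w]
  rw [hcard]
  exact hP.isContained_pathGraph

/-! ### The theorem -/

theorem order_le_of_isIndContained {l : ℕ} (hl : 1 ≤ l) (c : Choices (h l)) {m : ℕ}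
    (hm : (SimpleGraph.pathGraph m).IsIndContained (ribbedGraph l c)) :
    (m : ℝ) ≤ 201 * (l : ℝ) ^ 2 := by
  obtain ⟨φ⟩ := hm
  rcases Nat.eq_zero_or_pos m with rfl | hpos
  · simp only [Nat.cast_zero]
    positivity
  obtain ⟨n, rfl⟩ := Nat.exists_eq_add_of_le' hpos
  -- Only indices from `0` to `n` matter, where `Fin.ofNat` does not wrap around.
  have hf : IndPath (ribbedGraph l c) (fun x : ℤ => φ (Fin.ofNat (n + 1) x.toNat)) 0 n := by
    intro a b ha hab hb
    have ea : (Fin.ofNat (n + 1) a.toNat : Fin (n + 1)).val = a.toNat := by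
      simp only [Fin.val_ofNat]
      exact Nat.mod_eq_of_lt (by omega)
    have eb : (Fin.ofNat (n + 1) b.toNat : Fin (n + 1)).val = b.toNat := by
      simp only [Fin.val_ofNat]
      exact Nat.mod_eq_of_lt (by omega)
    refine ⟨fun he => ?_, ?_⟩
    · have := congrArg Fin.val (φ.injective he)
      rw [ea, eb] at this
      omega
    · rw [φ.map_adj_iff, SimpleGraph.pathGraph_adj, ea, eb]
      omega
  have := hf.order_le hl (by omega)
  have hl2 : (1 : ℤ) ≤ (l : ℤ) ^ 2 := by
    have : (1 : ℤ) ≤ l := by exact_mod_cast hl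
    nlinarith
  have hz : ((n + 1 : ℕ) : ℤ) ≤ 201 * (l : ℤ) ^ 2 := by
    push_cast
    linarith
  exact_mod_cast hz

theorem le_logb_card {l : ℕ} {n : ℕ} (hn : 2 ^ 2 ^ (l + 1) ≤ n) :
    (2 : ℝ) ^ (l + 1) ≤ Real.logb 2 n := by
  rw [Real.le_logb_iff_rpow_le (by norm_num) (by
    have : 0 < n := lt_of_lt_of_le (by positivity) hn
    exact_mod_cast this)]
  have : ((2 : ℝ) ^ (l + 1)) = ((2 ^ (l + 1) : ℕ) : ℝ) := by push_cast; rfl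
  rw [this, Real.rpow_natCast]
  exact_mod_cast hn

theorem le_logb_logb_card {l : ℕ} {n : ℕ} (hn : 2 ^ 2 ^ (l + 1) ≤ n) :
    (l : ℝ) ≤ Real.logb 2 (Real.logb 2 n) := by
  have h1 := le_logb_card hn
  have h2 : (0 : ℝ) < Real.logb 2 n := lt_of_lt_of_le (by positivity) h1
  rw [Real.le_logb_iff_rpow_le (by norm_num) h2, Real.rpow_natCast]
  exact le_trans (pow_le_pow_right₀ (by norm_num) (by omega)) h1

/-- Powers grow faster than squares. -/
theorem exists_sq_lt_rpow {c : ℝ} (hc : 0 < c) :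
    ∃ l : ℕ, 1 ≤ l ∧ 201 * (l : ℝ) ^ 2 < ((2 : ℝ) ^ (l + 1)) ^ c := by
  have hb : (1 : ℝ) < 2 ^ c := Real.one_lt_rpow (by norm_num) hc
  -- The base `2 ^ c` exceeds `1`, so `l ^ 2 / (2 ^ c) ^ l` tends to `0` and drops below `1 / 201`.
  have htend := tendsto_pow_const_div_const_pow_of_one_lt 2 hb
  have hev := htend.eventually (gt_mem_nhds (show (0 : ℝ) < 1 / 201 by norm_num))
  obtain ⟨l, h1, h2⟩ := (hev.and (Filter.eventually_ge_atTop 1)).exists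
  refine ⟨l, h2, ?_⟩
  have hpos : (0 : ℝ) < (2 ^ c) ^ l := by positivity
  rw [div_lt_iff₀ hpos] at h1
  have h3 : ((2 : ℝ) ^ c) ^ l ≤ ((2 : ℝ) ^ (l + 1)) ^ c := by
    rw [← Real.rpow_natCast (2 ^ c) l, ← Real.rpow_mul (by norm_num), mul_comm c,
      Real.rpow_mul (by norm_num), Real.rpow_natCast]
    exact Real.rpow_le_rpow (by positivity) (pow_le_pow_right₀ (by norm_num) (by omega)) hc.le
  linarith

end RibbedBlowUp

theorem theorem1p6 :
    -- the main claim, with the path of order `n` being Hamiltonian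
    (∃ c : ℝ, {n : ℕ | ∃ (V : Type) (_ : Fintype V) (G : SimpleGraph V),
        RibbedBlowUp.IsDegenerate G 2 ∧
        (SimpleGraph.pathGraph n).IsContained G ∧
        Fintype.card V = n ∧ RibbedBlowUp.HasHamiltonianPath G ∧
        ∀ m : ℕ, (SimpleGraph.pathGraph m).IsIndContained G →
          (m : ℝ) ≤ c * (Real.logb 2 (Real.logb 2 (n : ℝ))) ^ 2}.Infinite) ∧
    -- the graphs `G_ℓ` are witnesses, for all choices made in their construction
    (∃ c : ℝ, ∀ l : ℕ, 1 ≤ l → ∀ ch : RibbedBlowUp.Choices (RibbedBlowUp.h l),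
        Finite (RibbedBlowUp.Vertex (RibbedBlowUp.h l)) ∧
        2 ^ 2 ^ (l + 1) ≤ Nat.card (RibbedBlowUp.Vertex (RibbedBlowUp.h l)) ∧
        RibbedBlowUp.IsDegenerate (RibbedBlowUp.ribbedGraph l ch) 2 ∧
        RibbedBlowUp.HasHamiltonianPath (RibbedBlowUp.ribbedGraph l ch) ∧
        ∀ m : ℕ, (SimpleGraph.pathGraph m).IsIndContained (RibbedBlowUp.ribbedGraph l ch) →
          (m : ℝ) ≤ c * (l : ℝ) ^ 2) ∧
    -- the conjecture of Esperet, Lemoine and Maffray fails for every `k ≥ 2`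
    (∀ k : ℕ, 2 ≤ k → ¬ ∃ c : ℝ, 0 < c ∧
        ∀ (V : Type) [Fintype V] (G : SimpleGraph V), RibbedBlowUp.IsDegenerate G k →
          ∀ n : ℕ, 1 ≤ n → (SimpleGraph.pathGraph n).IsContained G →
            ∃ m : ℕ, (SimpleGraph.pathGraph m).IsIndContained G ∧
              (Real.logb 2 (n : ℝ)) ^ c ≤ (m : ℝ)) := by
  refine ⟨⟨201, ?_⟩, ⟨201, ?_⟩, ?_⟩
  · refine Set.infinite_of_not_bddAbove ?_
    rintro ⟨B, hB⟩
    -- The order of `G_l` exceeds `l`, hence the supposed upper bound `B`.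
    let l := B + 1
    have hl : 1 ≤ l := Nat.le_add_left 1 B
    obtain ⟨ch⟩ : Nonempty (RibbedBlowUp.Choices (RibbedBlowUp.h l)) := inferInstance
    have := RibbedBlowUp.finite_vertex (RibbedBlowUp.h l)
    have := Fintype.ofFinite (RibbedBlowUp.Vertex (RibbedBlowUp.h l))
    have hcard := RibbedBlowUp.two_pow_two_pow_le_card hl
    rw [Nat.card_eq_fintype_card] at hcard
    have hham := RibbedBlowUp.hasHamiltonianPath_ribbedGraph hl ch
    have hle := hB (a := Fintype.card (RibbedBlowUp.Vertex (RibbedBlowUp.h l)))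
      ⟨_, inferInstance, RibbedBlowUp.ribbedGraph l ch, RibbedBlowUp.isDegenerate_ribbedGraph hl ch,
        hham.isContained_pathGraph, rfl, hham, fun m hm => by
          refine (RibbedBlowUp.order_le_of_isIndContained hl ch hm).trans ?_
          have := RibbedBlowUp.le_logb_logb_card hcard
          gcongr⟩
    have h1 : l < 2 ^ 2 ^ (l + 1) :=
      lt_trans (by omega) (lt_trans (Nat.lt_two_pow_self (n := l + 1)) Nat.lt_two_pow_self)
    omega
  · intro l hl ch
    exact ⟨RibbedBlowUp.finite_vertex _, RibbedBlowUp.two_pow_two_pow_le_card hl,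
      RibbedBlowUp.isDegenerate_ribbedGraph hl ch,
      RibbedBlowUp.hasHamiltonianPath_ribbedGraph hl ch,
      fun m hm => RibbedBlowUp.order_le_of_isIndContained hl ch hm⟩
  · rintro k hk ⟨c, hc, hall⟩
    obtain ⟨l, hl, hlt⟩ := RibbedBlowUp.exists_sq_lt_rpow hc
    obtain ⟨ch⟩ : Nonempty (RibbedBlowUp.Choices (RibbedBlowUp.h l)) := inferInstance
    have := RibbedBlowUp.finite_vertex (RibbedBlowUp.h l)
    have := Fintype.ofFinite (RibbedBlowUp.Vertex (RibbedBlowUp.h l))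
    have hcard := RibbedBlowUp.two_pow_two_pow_le_card hl
    rw [Nat.card_eq_fintype_card] at hcard
    obtain ⟨m, hm, hlog⟩ := hall _ (RibbedBlowUp.ribbedGraph l ch)
      ((RibbedBlowUp.isDegenerate_ribbedGraph hl ch).mono hk)
      (Fintype.card (RibbedBlowUp.Vertex (RibbedBlowUp.h l)))
      (le_trans Nat.one_le_two_pow hcard)
      (RibbedBlowUp.hasHamiltonianPath_ribbedGraph hl ch).isContained_pathGraph
    have h1 := RibbedBlowUp.order_le_of_isIndContained hl ch hm
    have h2 := Real.rpow_le_rpow (by positivity) (RibbedBlowUp.le_logb_card hcard) hc.le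
    linarith
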